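/- Let $K$ be an algebraically closed field with an absolute value $|\cdot|$ (archimedean or nonarchimedean), $\pi\colon X\to\operatorname{Spec}K$ a projective variety (an integral closed subscheme of some $\mathbb P^n_K$), and $L$ a line bundle on $X$. A metric on $L$ is a collection of $K$-norms on the fibres $L(x)$, $x\in X(K)$, and $X(K)$ carries the topology defined by $|\cdot|$. A metric $\|\cdot\|$ is called bounded and continuous if the following holds. If $K$ is nonarchimedean with valuation ring $R$: there are an integer $e\ge 1$ and a projective flat model $(\widetilde X,\widetilde L)$ of $(X,L^{\otimes e})$ over $R$ such that $\log(\|\cdot\|/\|\cdot\|_{\widetilde L})$ is a bounded continuous function on $X(K)$, where $\|\ell\|_{\widetilde L}(x)=\inf\{|a|^{1/e}: a\in K,\ \ell^{\otimes e}\in a\,\widetilde x^*\widetilde L\}$ and $\widetilde x\colon\operatorname{Spec}R\to\widetilde X$ is the extension of $x$. If $K$ is archimedean: $\|s\|$ is continuous for every local frame $s$ of $L$, and $\log\|s\|$ is bounded on every bounded subset of $V(K)$ for $V$ affine open and $s$ a frame of $L$ near $V$ (for $K=\mathbb C$ the second condition follows from the first). Let $\overline{\mathcal H}$ be the set of pairs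 $\overline f=(f,\varphi)$ where $f\colon X\to X$ is a morphism over $K$ and $\varphi\colon L^{\otimes d_f}\xrightarrow{\sim}f^*L$ is an isomorphism for some integer $d_f\ge 2$ (which is part of the data). Let $\|\cdot\|$ be a bounded continuous metric on $L$. Put $$\overline c(\overline f)=\sup_{x\in X(K)}\left|\log\frac{(\varphi^*f^*\|\cdot\|)^{1/d_f}}{\|\cdot\|}(x)\right|,\qquad \overline c(\overline{\mathbf f})=\sup_{i\ge1}\overline c(\overline{f_i})\in[0,+\infty]$$ for $\overline{\mathbf f}=(\overline{f_i})_{i\ge1}=((f_i,\varphi_i))_{i\ge 1}$ with $\overline{f_i}\in\overline{\mathcal H}$. Let $\overline{\mathcal B}$ be the set of sequences $\overline{\mathbf f}$ with $\overline c(\overline{\mathbf f})<+\infty$, and $S((\overline{f_i})_{i\ge1})=(\overline{f_{i+1}})_{i\ge1}$ the shift map, which sends $\overline{\mathcal B}$ to itself. **Theorem 5.1.** There is a unique way to attach to each $\overline{\mathbf f}\in\overline{\mathcal B}$ a metric $\widehat{\|\cdot\|}_{L,\overline{\mathbf f}}$ on $L$ such that, for all $\overline{\mathbf f}\in\overline{\mathcal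 B}$: (i) $\widehat{\|\cdot\|}_{L,\overline{\mathbf f}}$ is bounded and continuous, and $\displaystyle\sup_{x\in X(K)}\left|\log\frac{\widehat{\|\cdot\|}_{L,\overline{\mathbf f}}}{\|\cdot\|}(x)\right|\le 2\,\overline c(\overline{\mathbf f})$; (ii) $\varphi_1^*f_1^*\widehat{\|\cdot\|}_{L,S(\overline{\mathbf f})}=\widehat{\|\cdot\|}_{L,\overline{\mathbf f}}^{\,d_{f_1}}$ as metrics on $L^{\otimes d_{f_1}}$. Moreover, the set $\overline{\mathcal B}$ and the metrics $\widehat{\|\cdot\|}_{L,\overline{\mathbf f}}$ do not depend on the choice of the bounded continuous metric $\|\cdot\|$ on $L$. -/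

import Mathlib

open CategoryTheory TopologicalSpace AlgebraicGeometry
open scoped ENNReal

universe u

noncomputable section

namespace AdmMetric

attribute [local instance] MvPolynomial.gradedAlgebra

/-! ### Projective schemes over an affine base -/

/-- Projective `n`-space over `Spec A`, as `Proj A[T_0, …, T_n]`. -/
abbrev ProjSpace (n : ℕ) (A : Type u) [CommRing A] : Scheme.{u} :=
  Proj (MvPolynomial.homogeneousSubmodule (Fin (n + 1)) A)

/-- The structure morphism of projective space. -/
def ProjSpace.toSpec (n : ℕ) (A : Type u) [CommRing A] : ProjSpace n A ⟶ Spec (.of A) :=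
  Proj.toSpecZero (MvPolynomial.homogeneousSubmodule (Fin (n + 1)) A) ≫
    Spec.map (CommRingCat.ofHom
      (algebraMap A (MvPolynomial.homogeneousSubmodule (Fin (n + 1)) A 0)))

/-- `X` is projective over `Spec A`: it is a closed subscheme of some projective space. -/
def IsProjectiveOver {X : Scheme.{u}} {A : Type u} [CommRing A] (π : X ⟶ Spec (.of A)) : Prop :=
  ∃ (n : ℕ) (i : X ⟶ ProjSpace n A), IsClosedImmersion i ∧ i ≫ ProjSpace.toSpec n A = π

/-! ### Restriction and evaluation of regular functions -/

/-- Restriction of regular functions. -/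
def res {X : Scheme.{u}} {U V : X.Opens} (h : V ≤ U) : Γ(X, U) →+* Γ(X, V) :=
  (X.presheaf.map (homOfLE h).op).hom

/-- The pullback of regular functions along `f : Y ⟶ X`. -/
def pull {X Y : Scheme.{u}} (f : Y ⟶ X) (U : X.Opens) : Γ(X, U) →+* Γ(Y, f ⁻¹ᵁ U) :=
  (f.app U).hom

variable {K : Type u} [NormedField K]

/-- The `K`-valued point `x : Spec K ⟶ X` lies in the open subset `U`. -/
def Lies {X : Scheme.{u}} (x : Spec (.of K) ⟶ X) (U : X.Opens) : Prop :=
  ⊤ ≤ x ⁻¹ᵁ U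

/-- The value `s(x)` of a regular function `s` on `U` at a `K`-valued point `x` of `U`. -/
def eval {X : Scheme.{u}} (x : Spec (.of K) ⟶ X) {U : X.Opens} (h : Lies x U) : Γ(X, U) →+* K :=
  ((x.appLE U ⊤ h) ≫ (Scheme.ΓSpecIso (.of K)).hom).hom

theorem Lies.mono {X : Scheme.{u}} {x : Spec (.of K) ⟶ X} {U V : X.Opens} (h : Lies x V)
    (e : V ≤ U) : Lies x U :=
  fun _ hp => e (h hp)

theorem Lies.inf {X : Scheme.{u}} {x : Spec (.of K) ⟶ X} {U V : X.Opens} (h : Lies x U)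
    (h' : Lies x V) : Lies x (U ⊓ V) :=
  fun _ hp => ⟨h hp, h' hp⟩

theorem exists_lies {X : Scheme.{u}} (x : Spec (.of K) ⟶ X) {ι : Type u} (U : ι → X.Opens)
    (hU : ⨆ i, U i = ⊤) : ∃ i, Lies x (U i) := by
  let p : Spec (.of K) := IsLocalRing.closedPoint K
  have hp : x p ∈ ⨆ i, U i := by rw [hU]; trivial
  obtain ⟨i, hi⟩ := Opens.mem_iSup.1 hp
  refine ⟨i, fun q _ => ?_⟩
  have : q = p := Subsingleton.elim (α := PrimeSpectrum K) q p
  subst this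
  exact hi

theorem eval_res {X : Scheme.{u}} (x : Spec (.of K) ⟶ X) {U V : X.Opens} (e : V ≤ U)
    (h : Lies x V) (s : Γ(X, U)) : eval x h (res e s) = eval x (h.mono e) s := by
  have := Scheme.Hom.map_appLE x h (homOfLE e).op
  simp only [eval, res]
  rw [← this]
  rfl

theorem eval_pull {X Y : Scheme.{u}} (f : Y ⟶ X) (x : Spec (.of K) ⟶ Y) {U : X.Opens}
    (h : Lies x (f ⁻¹ᵁ U)) (h' : Lies (x ≫ f) U) (s : Γ(X, U)) :
    eval x h (pull f U s) = eval (x ≫ f) h' s := by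
  have := Scheme.Hom.comp_appLE x f U ⊤ h'
  simp only [eval, pull]
  rw [this]
  rfl

/-! ### Line bundles -/

/-- A line bundle on `X`, given by a trivialising open cover `U i` and a cocycle of transition
functions `g i j`, which are units on `U i ∩ U j`.  With respect to the local frames `e i` one has
`e j = g i j • e i`; a section is a family of functions `s i` on `U i` with
`s i = g i j * s j` on `U i ∩ U j`. -/
structure LineBundle (X : Scheme.{u}) where
  /-- the index set of the trivialising cover -/
  ι : Type u
  /-- the trivialising cover -/
  U : ι → X.Opens
  cover : ⨆ i, U i = ⊤
  /-- the transition functions -/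
  g : ∀ i j, (Γ(X, U i ⊓ U j))ˣ
  cocycle : ∀ (i j k : ι) (W : X.Opens) (hi : W ≤ U i) (hj : W ≤ U j) (hk : W ≤ U k),
    res (le_inf hi hj) (g i j).1 * res (le_inf hj hk) (g j k).1 = res (le_inf hi hk) (g i k).1

namespace LineBundle

variable {X Y : Scheme.{u}}

/-- The tensor power `L^{⊗ d}`. -/
def pow (L : LineBundle X) (d : ℕ) : LineBundle X where
  ι := L.ι
  U := L.U
  cover := L.cover
  g i j := L.g i j ^ d
  cocycle i j k W hi hj hk := by
    simp only [Units.val_pow_eq_pow_val, map_pow, ← mul_pow, L.cocycle i j k W hi hj hk]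

/-- The pullback `f^* L`. -/
def pullback (L : LineBundle X) (f : Y ⟶ X) : LineBundle Y where
  ι := L.ι
  U i := f ⁻¹ᵁ (L.U i)
  cover := by
    ext y
    have : f y ∈ ⨆ i, L.U i := by rw [L.cover]; trivial
    obtain ⟨i, hi⟩ := Opens.mem_iSup.1 this
    simp only [Opens.coe_top, Set.mem_univ, iff_true, SetLike.mem_coe]
    exact Opens.mem_iSup.2 ⟨i, hi⟩
  g i j := Units.map (pull f (L.U i ⊓ L.U j)).toMonoidHom (L.g i j)
  cocycle i j k W hi hj hk := by
    let T := L.U i ⊓ L.U j ⊓ L.U k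
    have hW : W ≤ f ⁻¹ᵁ T := fun y hy => ⟨⟨hi hy, hj hy⟩, hk hy⟩
    have key : ∀ (a b : L.ι) (e : T ≤ L.U a ⊓ L.U b) (e' : W ≤ f ⁻¹ᵁ (L.U a ⊓ L.U b)),
        res e' (pull f (L.U a ⊓ L.U b) (L.g a b).1) =
          res hW (pull f T (res e (L.g a b).1)) := by
      intro a b e e'
      have h1 := Scheme.Hom.map_appLE f hW (homOfLE e).op
      have h2 := Scheme.Hom.appLE_map f (le_refl (f ⁻¹ᵁ T)) (homOfLE hW).op
      have h3 := Scheme.Hom.appLE_map f (le_refl (f ⁻¹ᵁ (L.U a ⊓ L.U b))) (homOfLE e').op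
      rw [Scheme.Hom.appLE_eq_app] at h2 h3
      have := h3.trans (h1.symm.trans (congrArg _ h2.symm))
      exact congrArg (fun q => q.hom (L.g a b).1) this
    have hc := L.cocycle i j k T (inf_le_left.trans inf_le_left) (inf_le_left.trans inf_le_right)
      inf_le_right
    have := congrArg (fun q => res hW (pull f T q)) hc
    simp only [map_mul] at this
    rw [← key, ← key, ← key] at this
    exact this

/-- An isomorphism of line bundles `L ≅ M`: in the local frames it is multiplication by units
`u i k` on `U i ∩ V k`, compatible with the transition functions on both sides. -/
structure Iso (L M : LineBundle X) where
  /-- the units expressing the isomorphism in the local frames -/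
  u : ∀ (i : L.ι) (k : M.ι), (Γ(X, L.U i ⊓ M.U k))ˣ
  compat : ∀ (i j : L.ι) (k l : M.ι) (W : X.Opens) (hi : W ≤ L.U i) (hj : W ≤ L.U j)
    (hk : W ≤ M.U k) (hl : W ≤ M.U l),
    res (le_inf hi hk) (u i k).1 * res (le_inf hi hj) (L.g i j).1 =
      res (le_inf hk hl) (M.g k l).1 * res (le_inf hj hl) (u j l).1

/-- A global section of `L`. -/
structure Section (L : LineBundle X) where
  /-- the section in the local frames -/
  s : ∀ i, Γ(X, L.U i)
  compat : ∀ (i j : L.ι) (W : X.Opens) (hi : W ≤ L.U i) (hj : W ≤ L.U j),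
    res hi (s i) = res (le_inf hi hj) (L.g i j).1 * res hj (s j)

/-- The fibre `L(x) = x^* L` at a `K`-valued point, a one-dimensional `K`-vector space: its elements
are families of coordinates in all frames at `x`, related by the transition functions. -/
def Fiber (L : LineBundle X) (x : Spec (.of K) ⟶ X) : Submodule K ({i // Lies x (L.U i)} → K) where
  carrier := {v | ∀ i j, v i = eval x (i.2.inf j.2) (L.g i.1 j.1).1 * v j}
  add_mem' := by
    intro v w hv hw i j
    simp only [Pi.add_apply, mul_add, ← hv i j, ← hw i j]
  zero_mem' := by intro i j; simp
  smul_mem' := by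
    intro a v hv i j
    simp only [Pi.smul_apply, smul_eq_mul]
    rw [hv i j]; ring

theorem eval_cocycle (L : LineBundle X) (x : Spec (.of K) ⟶ X) (i j k : {i // Lies x (L.U i)}) :
    eval x (i.2.inf j.2) (L.g i.1 j.1).1 * eval x (j.2.inf k.2) (L.g j.1 k.1).1 =
      eval x (i.2.inf k.2) (L.g i.1 k.1).1 := by
  have h := L.cocycle i.1 j.1 k.1 (L.U i.1 ⊓ L.U j.1 ⊓ L.U k.1) (inf_le_left.trans inf_le_left)
    (inf_le_left.trans inf_le_right) inf_le_right
  have := congrArg (eval x ((i.2.inf j.2).inf k.2)) h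
  simpa only [map_mul, eval_res] using this

theorem eval_unit_ne_zero {x : Spec (.of K) ⟶ X} {U : X.Opens} (h : Lies x U) (s : (Γ(X, U))ˣ) :
    eval x h s.1 ≠ 0 :=
  (s.isUnit.map (eval x h)).ne_zero

theorem eval_self (L : LineBundle X) (x : Spec (.of K) ⟶ X) (i : {i // Lies x (L.U i)}) :
    eval x (i.2.inf i.2) (L.g i.1 i.1).1 = 1 := by
  have h := L.eval_cocycle x i i i
  exact mul_left_cancel₀ (eval_unit_ne_zero _ _) (h.trans (mul_one _).symm)

/-- The value `e_i(x) ∈ L(x)` of the local frame `e_i` at a point of `U i`. -/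
def frame (L : LineBundle X) (x : Spec (.of K) ⟶ X) (i : {i // Lies x (L.U i)}) : L.Fiber x :=
  ⟨fun j => eval x (j.2.inf i.2) (L.g j.1 i.1).1, fun j k => (L.eval_cocycle x j k i).symm⟩

/-- Some index of the cover whose open set contains `x`. -/
def idx (L : LineBundle X) (x : Spec (.of K) ⟶ X) : {i // Lies x (L.U i)} :=
  ⟨_, (exists_lies x L.U L.cover).choose_spec⟩

theorem frame_self (L : LineBundle X) (x : Spec (.of K) ⟶ X) (i : {i // Lies x (L.U i)}) :
    (L.frame x i).1 i = 1 := L.eval_self x i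

theorem eq_smul_frame (L : LineBundle X) (x : Spec (.of K) ⟶ X) (v : L.Fiber x)
    (i : {i // Lies x (L.U i)}) : v = v.1 i • L.frame x i := by
  ext j
  simp only [Submodule.coe_smul, Pi.smul_apply, smul_eq_mul, frame]
  rw [v.2 j i, mul_comm]

theorem frame_ne_zero (L : LineBundle X) (x : Spec (.of K) ⟶ X) (i : {i // Lies x (L.U i)}) :
    L.frame x i ≠ 0 := by
  intro h
  have := L.frame_self x i
  rw [h] at this
  simp at this

theorem coord_ne_zero (L : LineBundle X) (x : Spec (.of K) ⟶ X) {v : L.Fiber x} (hv : v ≠ 0)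
    (i : {i // Lies x (L.U i)}) : v.1 i ≠ 0 := by
  intro h
  apply hv
  rw [L.eq_smul_frame x v i, h, zero_smul]

/-- The map `v ↦ v^{⊗ d}` from `L(x)` to `L^{⊗ d}(x)`. -/
def tpow (L : LineBundle X) (d : ℕ) {x : Spec (.of K) ⟶ X} (v : L.Fiber x) : (L.pow d).Fiber x :=
  ⟨fun i => v.1 i ^ d, fun i j => by
    have h := v.2 i j
    have e : eval x (i.2.inf j.2) (L.g i.1 j.1 ^ d : (Γ(X, L.U i.1 ⊓ L.U j.1))ˣ).1 =
        eval x (i.2.inf j.2) (L.g i.1 j.1).1 ^ d := by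
      exact map_pow (eval x (i.2.inf j.2)) (L.g i.1 j.1).1 d
    exact (congrArg (· ^ d) h).trans ((mul_pow _ _ _).trans (congrArg (· * _) e.symm))⟩

/-- The canonical isomorphism between the fibre of `f^* L` at `x` and the fibre of `L` at `f(x)`. -/
def pullbackFiber (L : LineBundle X) (f : Y ⟶ X) (x : Spec (.of K) ⟶ Y) :
    (L.pullback f).Fiber x ≃ₗ[K] L.Fiber (x ≫ f) where
  toFun v := ⟨fun i => v.1 ⟨i.1, i.2⟩, fun i j => by
    have h := v.2 ⟨i.1, i.2⟩ ⟨j.1, j.2⟩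
    refine h.trans (congrArg (· * _) ?_)
    exact eval_pull f x _ (i.2.inf j.2) _⟩
  invFun v := ⟨fun i => v.1 ⟨i.1, i.2⟩, fun i j => by
    have h := v.2 ⟨i.1, i.2⟩ ⟨j.1, j.2⟩
    refine h.trans (congrArg (· * _) ?_)
    exact (eval_pull (U := L.U i.1 ⊓ L.U j.1) f x (i.2.inf j.2) _ _).symm⟩
  map_add' _ _ := rfl
  map_smul' _ _ := rfl
  left_inv _ := rfl
  right_inv _ := rfl

/-- The linear map `L(x) → M(x)` induced by an isomorphism `L ≅ M` of line bundles. -/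
def Iso.fiberMap {L M : LineBundle X} (φ : Iso L M) (x : Spec (.of K) ⟶ X) :
    L.Fiber x →ₗ[K] M.Fiber x where
  toFun v := ⟨fun k => eval x ((L.idx x).2.inf k.2) (φ.u (L.idx x).1 k.1).1 * v.1 (L.idx x),
    fun k l => by
      have h := φ.compat (L.idx x).1 (L.idx x).1 k.1 l.1 (L.U (L.idx x).1 ⊓ (M.U k.1 ⊓ M.U l.1))
        inf_le_left inf_le_left (inf_le_right.trans inf_le_left) (inf_le_right.trans inf_le_right)
      have h' := congrArg (eval x ((L.idx x).2.inf (k.2.inf l.2))) h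
      simp only [map_mul, eval_res] at h'
      rw [L.eval_self x (L.idx x), mul_one] at h'
      exact (congrArg (· * _) h').trans (mul_assoc _ _ _)⟩
  map_add' v w := by ext k; simp [mul_add]
  map_smul' a v := by ext k; simp; ring

/-- The induced map on fibres does not depend on the frame used to describe it. -/
theorem Iso.fiberMap_apply {L M : LineBundle X} (φ : Iso L M) (x : Spec (.of K) ⟶ X)
    (v : L.Fiber x) (i : {i // Lies x (L.U i)}) (k : {k // Lies x (M.U k)}) :
    (φ.fiberMap x v).1 k = eval x (i.2.inf k.2) (φ.u i.1 k.1).1 * v.1 i := by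
  have h := φ.compat i.1 (L.idx x).1 k.1 k.1 (L.U i.1 ⊓ L.U (L.idx x).1 ⊓ M.U k.1)
    (inf_le_left.trans inf_le_left) (inf_le_left.trans inf_le_right) inf_le_right inf_le_right
  have h' := congrArg (eval x ((i.2.inf (L.idx x).2).inf k.2)) h
  simp only [map_mul, eval_res] at h'
  rw [M.eval_self x k, one_mul] at h'
  change eval x ((L.idx x).2.inf k.2) (φ.u (L.idx x).1 k.1).1 * v.1 (L.idx x) = _
  rw [← h', mul_assoc, ← v.2 i (L.idx x)]

theorem Iso.fiberMap_ne_zero {L M : LineBundle X} (φ : Iso L M) (x : Spec (.of K) ⟶ X)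
    {v : L.Fiber x} (hv : v ≠ 0) : φ.fiberMap x v ≠ 0 := by
  intro h
  have h1 := φ.fiberMap_apply x v (L.idx x) (M.idx x)
  rw [h] at h1
  exact mul_ne_zero (eval_unit_ne_zero _ _) (L.coord_ne_zero x hv _) h1.symm

end LineBundle

/-! ### Rational points and metrics -/

/-- The set `X(K)` of `K`-rational points of a `K`-scheme. -/
@[ext]
structure Points {X : Scheme.{u}} (π : X ⟶ Spec (.of K)) : Type u where
  /-- the underlying morphism -/
  pt : Spec (.of K) ⟶ X
  comm : pt ≫ π = 𝟙 (Spec (.of K))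

/-- The map on rational points induced by a morphism over `K`. -/
def Points.map {X Y : Scheme.{u}} {π : X ⟶ Spec (.of K)} {π' : Y ⟶ Spec (.of K)} (f : X ⟶ Y)
    (hf : f ≫ π' = π) (x : Points π) : Points π' :=
  ⟨x.pt ≫ f, by rw [Category.assoc, hf, x.comm]⟩

/-- The `K`-topology on `X(K)`: the coarsest one such that `U(K)` is open and `s : U(K) → K` is
continuous for all Zariski open `U` and all regular functions `s` on `U`. -/
instance Points.topology {X : Scheme.{u}} (π : X ⟶ Spec (.of K)) : TopologicalSpace (Points π) :=
  TopologicalSpace.generateFrom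
    {S | ∃ (U : X.Opens) (s : Γ(X, U)) (W : Set K), IsOpen W ∧
      S = {x : Points π | ∃ h : Lies x.pt U, eval x.pt h s ∈ W}}

/-- A metric on `L`: a `K`-norm on each fibre `L(x)`, `x ∈ X(K)`.  (Fibres are one-dimensional, so
the triangle inequality is automatic.) -/
@[ext]
structure Metric {X : Scheme.{u}} (π : X ⟶ Spec (.of K)) (L : LineBundle X) where
  /-- the norm on the fibre at `x` -/
  norm : ∀ x : Points π, L.Fiber x.pt → ℝ
  norm_smul : ∀ (x : Points π) (a : K) (v : L.Fiber x.pt), norm x (a • v) = ‖a‖ * norm x v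
  norm_pos : ∀ (x : Points π) (v : L.Fiber x.pt), v ≠ 0 → 0 < norm x v

namespace Metric

variable {X Y : Scheme.{u}} {π : X ⟶ Spec (.of K)} {π' : Y ⟶ Spec (.of K)} {L M : LineBundle X}

/-- The metric `‖·‖^d` on `L^{⊗ d}`, which is characterised by `‖v^{⊗ d}‖ = ‖v‖^d` for `v ∈ L(x)`. -/
def pow (m : Metric π L) (d : ℕ) : Metric π (L.pow d) where
  norm x w := ‖w.1 (L.idx x.pt)‖ * m.norm x (L.frame x.pt (L.idx x.pt)) ^ d
  norm_smul x a w := by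
    have : (a • w).1 (L.idx x.pt) = a * w.1 (L.idx x.pt) := rfl
    rw [this, norm_mul, mul_assoc]
  norm_pos x w hw := mul_pos (norm_pos_iff.2 ((L.pow d).coord_ne_zero x.pt hw (L.idx x.pt)))
    (pow_pos (m.norm_pos x _ (L.frame_ne_zero x.pt _)) d)

theorem pow_tpow (m : Metric π L) (d : ℕ) (x : Points π) (v : L.Fiber x.pt) :
    (m.pow d).norm x (L.tpow d v) = m.norm x v ^ d := by
  conv_rhs => rw [L.eq_smul_frame x.pt v (L.idx x.pt), m.norm_smul, mul_pow, ← norm_pow]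
  rfl

/-- The metric `N^{1/d}` on `L` attached to a metric `N` on `L^{⊗ d}`. -/
def root {d : ℕ} (hd : d ≠ 0) (N : Metric π (L.pow d)) : Metric π L where
  norm x v := N.norm x (L.tpow d v) ^ (1 / (d : ℝ))
  norm_smul x a v := by
    have h : L.tpow d (a • v) = a ^ d • L.tpow d v := by
      ext i
      exact mul_pow a (v.1 i) d
    have h0 : 0 ≤ N.norm x (L.tpow d v) := by
      rcases eq_or_ne (L.tpow d v) 0 with h | h
      · have := N.norm_smul x 0 (L.tpow d v)
        rw [zero_smul, norm_zero, zero_mul] at this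
        rw [h, this]
      · exact (N.norm_pos x _ h).le
    rw [h, N.norm_smul, Real.mul_rpow (norm_nonneg _) h0, norm_pow, one_div,
      Real.pow_rpow_inv_natCast (norm_nonneg _) hd]
  norm_pos x v hv := by
    refine Real.rpow_pos_of_pos (N.norm_pos x _ ?_) _
    intro h
    have : v.1 (L.idx x.pt) ^ d = 0 := congrFun (congrArg Subtype.val h) (L.idx x.pt)
    exact pow_ne_zero d (L.coord_ne_zero x.pt hv _) this

/-- The pullback metric `f^* ‖·‖` on `f^* L`. -/
def pullback {L : LineBundle Y} (m : Metric π' L) (f : X ⟶ Y) (hf : f ≫ π' = π) :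
    Metric π (L.pullback f) where
  norm x v := m.norm (x.map f hf) (L.pullbackFiber f x.pt v)
  norm_smul x a v := by rw [map_smul]; exact m.norm_smul _ a _
  norm_pos x v hv := m.norm_pos _ _ ((L.pullbackFiber f x.pt).map_ne_zero_iff.2 hv)

/-- The metric `φ^* ‖·‖` on `L` for an isomorphism `φ : L ≅ M` and a metric on `M`. -/
def comap (m : Metric π M) (φ : LineBundle.Iso L M) : Metric π L where
  norm x v := m.norm x (φ.fiberMap x.pt v)
  norm_smul x a v := by rw [map_smul, m.norm_smul]
  norm_pos x v hv := m.norm_pos x _ (φ.fiberMap_ne_zero x.pt hv)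

/-- `sup_{x ∈ X(K)} |log (‖·‖' / ‖·‖)(x)|`, as an element of `[0, ∞]`; the ratio at `x` is computed
on the nonzero vectors of `L(x)`. -/
def logSup (m m' : Metric π L) : ℝ≥0∞ :=
  ⨆ (x : Points π) (v : L.Fiber x.pt) (_ : v ≠ 0),
    ENNReal.ofReal |Real.log (m'.norm x v / m.norm x v)|

end Metric

/-! ### Models over the valuation ring -/

/-- The valuation ring of a nonarchimedean field. -/
abbrev ValRing (K : Type u) [NormedField K] [IsUltrametricDist K] : ValuationSubring K :=
  (NormedField.valuation (K := K)).valuationSubring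

/-- The morphism `Spec K ⟶ Spec R`. -/
def generic (K : Type u) [NormedField K] [IsUltrametricDist K] :
    Spec (.of K) ⟶ Spec (.of (ValRing K)) :=
  Spec.map (CommRingCat.ofHom (algebraMap (ValRing K) K))

/-- A projective flat model `(X', L')` of `(X, L^{⊗ e})` over the valuation ring, for some `e ≥ 1`. -/
structure Model [IsUltrametricDist K] {X : Scheme.{u}} (π : X ⟶ Spec (.of K))
    (L : LineBundle X) where
  /-- the total space of the model -/
  X' : Scheme.{u}
  /-- the structure morphism -/
  π' : X' ⟶ Spec (.of (ValRing K))
  projective : IsProjectiveOver π'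
  flat : Flat π'
  /-- the inclusion of the generic fibre -/
  j : X ⟶ X'
  isPullback : IsPullback j π π' (generic K)
  /-- the line bundle on the model -/
  L' : LineBundle X'
  /-- the exponent -/
  e : ℕ
  e_pos : 0 < e
  /-- the identification of `L^{⊗ e}` with the restriction of `L'` -/
  φ : LineBundle.Iso (L.pow e) (L'.pullback j)

namespace Model

variable [IsUltrametricDist K] {X : Scheme.{u}} {π : X ⟶ Spec (.of K)} {L : LineBundle X}

/-- The lattice `Γ(Spec R, x'^* L')` in the fibre of `L'` at the `K`-valued point `y` of `X'`, where
`x' : Spec R ⟶ X'` is the (unique) section of the model extending `y`. -/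
def lattice (𝓜 : Model π L) (y : Spec (.of K) ⟶ 𝓜.X') : Set (𝓜.L'.Fiber y) :=
  {w | ∃ x' : Spec (.of (ValRing K)) ⟶ 𝓜.X', x' ≫ 𝓜.π' = 𝟙 _ ∧ generic K ≫ x' = y ∧
    ∃ s : (𝓜.L'.pullback x').Section,
      ∀ (i : 𝓜.L'.ι) (h : Lies y (𝓜.L'.U i)) (h' : Lies (generic K) (x' ⁻¹ᵁ (𝓜.L'.U i))),
        w.1 ⟨i, h⟩ = eval (generic K) h' (s.s i)}

/-- The model metric `‖ℓ‖ = inf {|a|^{1/e} : a ∈ K, ℓ^{⊗ e} ∈ a x'^* L'}`. -/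
def norm (𝓜 : Model π L) (x : Points π) (v : L.Fiber x.pt) : ℝ :=
  sInf {r | ∃ a : K, r = ‖a‖ ^ (1 / (𝓜.e : ℝ)) ∧ ∃ w ∈ 𝓜.lattice (x.pt ≫ 𝓜.j),
    𝓜.L'.pullbackFiber 𝓜.j x.pt (𝓜.φ.fiberMap x.pt (L.tpow 𝓜.e v)) = a • w}

end Model

/-! ### Bounded and continuous metrics -/

namespace Metric

variable {X : Scheme.{u}} {π : X ⟶ Spec (.of K)} {L : LineBundle X}

/-- Nonarchimedean case: `log (‖·‖ / ‖·‖_𝓜)` is bounded and continuous on `X(K)` for some model. -/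
def IsModelBoundedContinuous [IsUltrametricDist K] (m : Metric π L) : Prop :=
  ∃ (𝓜 : Model π L) (u : Points π → ℝ), Continuous u ∧ (∃ C, ∀ x, |u x| ≤ C) ∧
    ∀ (x : Points π) (v : L.Fiber x.pt), m.norm x v = Real.exp (u x) * 𝓜.norm x v

/-- The norms of the local frames are continuous functions on the open sets `U i (K)`. -/
def IsContinuous (m : Metric π L) : Prop :=
  ∀ i : L.ι, Continuous fun x : {x : Points π // Lies x.pt (L.U i)} =>
    m.norm x.1 (L.frame x.1.pt ⟨i, x.2⟩)

/-- `log ‖e_i‖` is bounded on every bounded subset `E` of `V(K)`, for `V` affine open in `U i`; here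
`E` is bounded if every regular function on `V` is bounded on `E`.  For `K = ℂ` and `X` projective
this follows from continuity. -/
def IsLocallyBounded (m : Metric π L) : Prop :=
  ∀ (i : L.ι) (V : X.Opens) (hV : V ≤ L.U i), IsAffineOpen V →
    ∀ E : Set {x : Points π // Lies x.pt V},
      (∀ s : Γ(X, V), ∃ C, ∀ x ∈ E, ‖eval x.1.pt x.2 s‖ ≤ C) →
      ∃ C, ∀ x ∈ E, |Real.log (m.norm x.1 (L.frame x.1.pt ⟨i, x.2.mono hV⟩))| ≤ C

/-- Bounded and continuous metrics, over an archimedean or nonarchimedean field. -/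
def IsBoundedContinuous (m : Metric π L) : Prop :=
  (∃ _ : IsUltrametricDist K, m.IsModelBoundedContinuous) ∨
    (¬ IsUltrametricDist K ∧ m.IsContinuous ∧ m.IsLocallyBounded)

end Metric

/-! ### Sequences of morphisms -/

/-- A pair `(f, φ)` of a morphism `f : X ⟶ X` over `K` and an isomorphism `φ : L^{⊗ d} ≅ f^* L` for
some `d ≥ 2`. -/
structure EndPair {X : Scheme.{u}} (π : X ⟶ Spec (.of K)) (L : LineBundle X) where
  /-- the morphism -/
  f : X ⟶ X
  comm : f ≫ π = π
  /-- the degree -/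
  d : ℕ
  two_le : 2 ≤ d
  /-- the isomorphism -/
  φ : LineBundle.Iso (L.pow d) (L.pullback f)

variable {X : Scheme.{u}} {π : X ⟶ Spec (.of K)} {L : LineBundle X}

/-- The metric `φ^* f^* ‖·‖` on `L^{⊗ d}`. -/
def EndPair.pullMetric (p : EndPair π L) (m : Metric π L) : Metric π (L.pow p.d) :=
  (m.pullback p.f p.comm).comap p.φ

/-- `c(f, φ) = sup_x |log ((φ^* f^* ‖·‖)^{1/d} / ‖·‖)(x)|`. -/
def EndPair.c (p : EndPair π L) (m : Metric π L) : ℝ≥0∞ :=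
  m.logSup ((p.pullMetric m).root (by have := p.two_le; omega))

/-- `c(𝐟) = sup_i c(f_i, φ_i)`. -/
def seqC (m : Metric π L) (p : ℕ → EndPair π L) : ℝ≥0∞ :=
  ⨆ i, (p i).c m

/-- The set of bounded sequences of pairs; the pair with index `i + 1` of the sequence is `p i`. -/
def BoundedSeq (m : Metric π L) : Set (ℕ → EndPair π L) :=
  {p | seqC m p < ⊤}

/-- The shift map `S` on bounded sequences. -/
def shift {m : Metric π L} (p : BoundedSeq m) : BoundedSeq m :=
  ⟨fun i => p.1 (i + 1),
    lt_of_le_of_lt (iSup_le fun i => le_iSup (fun i => (p.1 i).c m) (i + 1)) p.2⟩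

/-- The two properties which characterise the family of admissible metrics. -/
def IsAdmissibleFamily (m : Metric π L) (h : BoundedSeq m → Metric π L) : Prop :=
  ∀ p : BoundedSeq m,
    ((h p).IsBoundedContinuous ∧ m.logSup (h p) ≤ 2 * seqC m p.1) ∧
      (p.1 0).pullMetric (h (shift p)) = (h p).pow (p.1 0).d

end AdmMetric

end

noncomputable section

namespace AdmMetric

variable {K : Type u} [NormedField K]

/-! ### The topology on rational points -/

section Topology

variable {X Y : Scheme.{u}} {π : X ⟶ Spec (.of K)} {π' : Y ⟶ Spec (.of K)}

/-! Metrics on `L` are compared through the function `logRatio` on `X(K)`. The operation `rootPull`,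
i.e. `(φ^* f^* ‖·‖)^{1/d}`, composes this function with `f` and divides it by `d ≥ 2`
(`logRatio_rootPull`), so it contracts distances by a factor of at least two. Condition (ii) says
that `h p` is the `rootPull` of `h (S p)` (`root_eq_iff`).

Existence: iterating from `m` gives a telescoping series (`canonicalTerm`) whose `n`-th term is at
most `C / 2 ^ n`, with `C` the supremum attached to the sequence. Its sum `canonicalLog` is at most
`2 C`, is continuous as a uniform limit, and satisfies the functional equation after its zeroth term
is split off (`canonicalLog_eq`). The family is `m` twisted by `exp` of this sum. Uniqueness: two
solutions at uniformly bounded distance along the shift orbit are at distance at most `D / 2 ^ k`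
for every `k` (`eq_of_functional_equation`). The same argument compares families built from two
metrics `m`, `m'`, once these are at bounded distance.

The geometric input is that a bounded continuous metric is continuous in local frames, and that any
two of them are at bounded distance. For the latter, `X(K)` is a finite union of bounded subsets of
affine opens, obtained by dividing by the largest homogeneous coordinate (`exists_bounded_cover`).
These refine to bounded sets on which `L` is trivial (`BoundedIn.exists_refinement`), so local
boundedness suffices, and two models never have to be compared directly. In the nonarchimedean case
both properties are read off from the model: if the integral extension of a point stays in a chart
trivialising `L'`, the model norm of a frame is `‖unit‖ ^ (1 / e)` (`Model.norm_frame_eq`). Such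
points have integral values on the functions of the chart, which gives open neighbourhoods by finite
generation and bounded sets by quasi-compactness. -/

theorem Points.isOpen_eval_mem {U : X.Opens} (s : Γ(X, U)) {W : Set K} (hW : IsOpen W) :
    IsOpen {x : Points π | ∃ h : Lies x.pt U, eval x.pt h s ∈ W} :=
  isOpen_generateFrom_of_mem ⟨U, s, W, hW, rfl⟩

theorem Points.isOpen_lies (U : X.Opens) : IsOpen {x : Points π | Lies x.pt U} := by
  have := Points.isOpen_eval_mem (π := π) (0 : Γ(X, U)) isOpen_univ
  simpa using this

theorem Points.continuous_eval {U : X.Opens} (s : Γ(X, U)) :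
    Continuous fun x : {x : Points π // Lies x.pt U} => eval x.1.pt x.2 s := by
  refine continuous_def.2 fun W hW => ?_
  refine ⟨_, Points.isOpen_eval_mem (π := π) s hW, ?_⟩
  ext x
  exact ⟨fun ⟨_, h⟩ => h, fun h => ⟨x.2, h⟩⟩

theorem Points.continuous_map (f : X ⟶ Y) (hf : f ≫ π' = π) :
    Continuous (Points.map f hf : Points π → Points π') := by
  refine continuous_generateFrom_iff.2 ?_
  rintro _ ⟨U, s, W, hW, rfl⟩
  have := Points.isOpen_eval_mem (π := π) (pull f U s) hW
  convert this using 1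
  ext x
  constructor
  · rintro ⟨h, h'⟩
    exact ⟨h, by rw [eval_pull f x.pt (U := U) h h]; exact h'⟩
  · rintro ⟨h, h'⟩
    exact ⟨h, by rw [eval_pull f x.pt (U := U) h h] at h'; exact h'⟩

/-- Continuity may be checked on the open sets `U i (K)` of a Zariski open cover. -/
theorem Points.continuous_of_forall_lies {T : Type*} [TopologicalSpace T] {F : Points π → T}
    (h : ∀ x : Points π, ∃ U : X.Opens, Lies x.pt U ∧
      Continuous fun y : {y : Points π // Lies y.pt U} => F y.1) : Continuous F := by
  refine continuous_iff_continuousAt.2 fun x => ?_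
  obtain ⟨U, hx, hU⟩ := h x
  have hU' : ContinuousOn F {y : Points π | Lies y.pt U} :=
    continuousOn_iff_continuous_domRestrict.2 hU
  exact hU'.continuousAt ((Points.isOpen_lies U).mem_nhds hx)

end Topology

/-! ### Comparison of metrics -/

namespace Metric

variable {X : Scheme.{u}} {π : X ⟶ Spec (.of K)} {L : LineBundle X}

/-- The function `log (‖·‖' / ‖·‖)` on `X(K)`. -/
def logRatio (m m' : Metric π L) (x : Points π) : ℝ :=
  Real.log (m'.norm x (L.frame x.pt (L.idx x.pt)) / m.norm x (L.frame x.pt (L.idx x.pt)))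

theorem norm_frame_pos (m : Metric π L) (x : Points π) (i) : 0 < m.norm x (L.frame x.pt i) :=
  m.norm_pos x _ (L.frame_ne_zero x.pt i)

theorem norm_eq (m : Metric π L) (x : Points π) (v : L.Fiber x.pt) (i) :
    m.norm x v = ‖v.1 i‖ * m.norm x (L.frame x.pt i) := by
  conv_lhs => rw [L.eq_smul_frame x.pt v i, m.norm_smul]

/-- Fibres are lines, so the ratio of two norms does not depend on the vector, and the frame chosen
in `logRatio` is immaterial. -/
theorem norm_eq_exp_mul (m m' : Metric π L) (x : Points π) (v : L.Fiber x.pt) :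
    m'.norm x v = Real.exp (logRatio m m' x) * m.norm x v := by
  have h := m.norm_frame_pos x (L.idx x.pt)
  rw [logRatio, Real.exp_log (div_pos (m'.norm_frame_pos x _) h), m.norm_eq x v (L.idx x.pt),
    m'.norm_eq x v (L.idx x.pt)]
  field_simp

theorem log_div (m m' : Metric π L) (x : Points π) {v : L.Fiber x.pt} (hv : v ≠ 0) :
    Real.log (m'.norm x v / m.norm x v) = logRatio m m' x := by
  rw [norm_eq_exp_mul m m' x v, mul_div_cancel_right₀ _ (m.norm_pos x v hv).ne', Real.log_exp]

theorem logRatio_eq_of_norm_eq {m m' : Metric π L} {x : Points π} {r : ℝ}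
    (h : ∀ v, m'.norm x v = Real.exp r * m.norm x v) : logRatio m m' x = r := by
  rw [logRatio, h, mul_div_cancel_right₀ _ (m.norm_frame_pos x _).ne', Real.log_exp]

theorem logRatio_eq_sub_of_frame (m m' : Metric π L) (x : Points π) (i) :
    logRatio m m' x =
      Real.log (m'.norm x (L.frame x.pt i)) - Real.log (m.norm x (L.frame x.pt i)) := by
  rw [← log_div m m' x (L.frame_ne_zero x.pt i),
    Real.log_div (m'.norm_frame_pos x i).ne' (m.norm_frame_pos x i).ne']

theorem logRatio_add (m m' m'' : Metric π L) (x : Points π) :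
    logRatio m m' x + logRatio m' m'' x = logRatio m m'' x := by
  simp only [fun a b => logRatio_eq_sub_of_frame (π := π) (L := L) a b x (L.idx x.pt)]
  ring

theorem logRatio_symm (m m' : Metric π L) (x : Points π) :
    logRatio m' m x = -logRatio m m' x := by
  simp only [fun a b => logRatio_eq_sub_of_frame (π := π) (L := L) a b x (L.idx x.pt)]
  ring

theorem eq_of_logRatio_eq_zero {m m' : Metric π L} (h : ∀ x, logRatio m m' x = 0) : m' = m := by
  ext x v
  rw [norm_eq_exp_mul m m' x v, h, Real.exp_zero, one_mul]

theorem logSup_le_iff {m m' : Metric π L} {c : ℝ≥0∞} :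
    logSup m m' ≤ c ↔ ∀ x, ENNReal.ofReal |logRatio m m' x| ≤ c := by
  simp only [logSup, iSup_le_iff]
  exact ⟨fun h x => h x _ (L.frame_ne_zero x.pt (L.idx x.pt)),
    fun h x v hv => by rw [log_div m m' x hv]; exact h x⟩

/-- The sign condition matters: `ENNReal.ofReal` sends negative numbers to zero. -/
theorem logSup_le_ofReal_iff {m m' : Metric π L} {C : ℝ} (hC : 0 ≤ C) :
    logSup m m' ≤ ENNReal.ofReal C ↔ ∀ x, |logRatio m m' x| ≤ C := by
  simp only [logSup_le_iff, ENNReal.ofReal_le_ofReal_iff hC]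

/-- The metric `exp u • ‖·‖`. -/
def twist (m : Metric π L) (u : Points π → ℝ) : Metric π L where
  norm x v := Real.exp (u x) * m.norm x v
  norm_smul x a v := by rw [m.norm_smul]; ring
  norm_pos x v hv := mul_pos (Real.exp_pos _) (m.norm_pos x v hv)

@[simp]
theorem logRatio_twist (m : Metric π L) (u : Points π → ℝ) (x : Points π) :
    logRatio m (m.twist u) x = u x :=
  logRatio_eq_of_norm_eq fun _ => rfl

/-- Metrics on `L^{⊗ d}` are determined by the norms of the vectors `v^{⊗ d}`. -/
theorem ext_tpow {d : ℕ} {N N' : Metric π (L.pow d)}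
    (h : ∀ (x : Points π) (v : L.Fiber x.pt), N.norm x (L.tpow d v) = N'.norm x (L.tpow d v)) :
    N = N' := by
  -- The `d`-th power of a frame has coordinate one, hence spans the fibre of `L^{⊗ d}`.
  have key : ∀ (x : Points π) (w : (L.pow d).Fiber x.pt),
      w = w.1 (L.idx x.pt) • L.tpow d (L.frame x.pt (L.idx x.pt)) := by
    intro x w
    have h1 := (L.pow d).eq_smul_frame x.pt (L.tpow d (L.frame x.pt (L.idx x.pt))) (L.idx x.pt)
    have h2 : (L.tpow d (L.frame x.pt (L.idx x.pt))).1 (L.idx x.pt) = 1 := by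
      change (L.frame x.pt (L.idx x.pt)).1 (L.idx x.pt) ^ d = 1
      rw [L.frame_self, one_pow]
    rw [h1, h2, one_smul]
    exact (L.pow d).eq_smul_frame x.pt w (L.idx x.pt)
  ext x w
  rw [key x w, N.norm_smul, N'.norm_smul, h]

/-- Turns the functional equation on `L^{⊗ d}` into a fixed-point equation on `L`, where log ratios
can be used. -/
theorem root_eq_iff {d : ℕ} (hd : d ≠ 0) {N : Metric π (L.pow d)} {m : Metric π L} :
    N.root hd = m ↔ N = m.pow d := by
  have h0 : ∀ (x : Points π) (v : L.Fiber x.pt), 0 ≤ m.norm x v := fun x v => by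
    rw [m.norm_eq x v (L.idx x.pt)]
    exact mul_nonneg (norm_nonneg _) (m.norm_frame_pos x _).le
  have h0' : ∀ (x : Points π) (v : (L.pow d).Fiber x.pt), 0 ≤ N.norm x v := fun x v => by
    rw [N.norm_eq x v ((L.pow d).idx x.pt)]
    exact mul_nonneg (norm_nonneg _) (N.norm_frame_pos x _).le
  constructor
  · rintro rfl
    refine ext_tpow fun x v => ?_
    rw [pow_tpow]
    change _ = (N.norm x (L.tpow d v) ^ (1 / (d : ℝ))) ^ d
    rw [one_div, Real.rpow_inv_natCast_pow (h0' _ _) hd]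
  · rintro rfl
    ext x v
    change (m.pow d).norm x (L.tpow d v) ^ (1 / (d : ℝ)) = _
    rw [pow_tpow, one_div, Real.pow_rpow_inv_natCast (h0 _ _) hd]

/-- The log ratio of two continuous metrics is continuous. -/
theorem continuous_logRatio {m m' : Metric π L} (hm : m.IsContinuous) (hm' : m'.IsContinuous) :
    Continuous (logRatio m m') := by
  refine Points.continuous_of_forall_lies fun x => ?_
  obtain ⟨i, hi⟩ := L.idx x.pt
  refine ⟨L.U i, hi, ?_⟩
  refine Continuous.congr (((hm' i).log fun y => ?_).sub ((hm i).log fun y => ?_)) fun y => ?_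
  · exact (m'.norm_frame_pos y.1 ⟨i, y.2⟩).ne'
  · exact (m.norm_frame_pos y.1 ⟨i, y.2⟩).ne'
  · exact (logRatio_eq_sub_of_frame m m' y.1 ⟨i, y.2⟩).symm

theorem IsContinuous.twist {m : Metric π L} (hm : m.IsContinuous) {u : Points π → ℝ}
    (hu : Continuous u) : (m.twist u).IsContinuous := fun i =>
  (Real.continuous_exp.comp (hu.comp continuous_subtype_val)).mul (hm i)

theorem IsLocallyBounded.twist {m : Metric π L} (hm : m.IsLocallyBounded) {u : Points π → ℝ}
    {B : ℝ} (hB : ∀ x, |u x| ≤ B) : (m.twist u).IsLocallyBounded := by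
  intro i V hV hA E hE
  obtain ⟨C, hC⟩ := hm i V hV hA E hE
  refine ⟨B + C, fun x hx => ?_⟩
  change |Real.log (Real.exp (u x.1) * m.norm x.1 _)| ≤ _
  rw [Real.log_mul (Real.exp_pos _).ne' (m.norm_frame_pos _ _).ne', Real.log_exp]
  exact (abs_add_le _ _).trans (add_le_add (hB _) (hC x hx))

/-- In the nonarchimedean case the same model serves, with the comparison function changed by `u`.
-/
theorem IsBoundedContinuous.twist {m : Metric π L} (hm : m.IsBoundedContinuous)
    {u : Points π → ℝ} (hu : Continuous u) {B : ℝ} (hB : ∀ x, |u x| ≤ B) :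
    (m.twist u).IsBoundedContinuous := by
  rcases hm with ⟨hK, 𝓜, w, hw, ⟨C, hC⟩, h⟩ | ⟨hK, hc, hb⟩
  · refine Or.inl ⟨hK, 𝓜, fun x => u x + w x, hu.add hw,
      ⟨B + C, fun x => (abs_add_le _ _).trans (add_le_add (hB x) (hC x))⟩, fun x v => ?_⟩
    change Real.exp (u x) * m.norm x v = _
    rw [h, Real.exp_add, mul_assoc]
  · exact Or.inr ⟨hK, hc.twist hu, hb.twist hB⟩

end Metric

/-! ### Pulling back along a pair -/

namespace EndPair

variable {X : Scheme.{u}} {π : X ⟶ Spec (.of K)} {L : LineBundle X}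

theorem d_ne_zero (p : EndPair π L) : p.d ≠ 0 := by have := p.two_le; omega

/-- The metric `(φ^* f^* ‖·‖)^{1/d}` on `L`. -/
def rootPull (p : EndPair π L) (m : Metric π L) : Metric π L :=
  (p.pullMetric m).root p.d_ne_zero

/-- Both pulled back norms of `v` are `1/d`-th powers of norms of one vector `w` over `f(x)`. This
is the contraction behind existence and uniqueness. -/
theorem logRatio_rootPull (p : EndPair π L) (m m' : Metric π L) (x : Points π) :
    (p.rootPull m).logRatio (p.rootPull m') x = m.logRatio m' (x.map p.f p.comm) / p.d := by
  refine Metric.logRatio_eq_of_norm_eq fun v => ?_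
  let w : L.Fiber (x.map p.f p.comm).pt :=
    L.pullbackFiber p.f x.pt (p.φ.fiberMap x.pt (L.tpow p.d v))
  have h0 : 0 ≤ m.norm (x.map p.f p.comm) w := by
    rw [m.norm_eq _ w (L.idx _)]
    exact mul_nonneg (norm_nonneg _) (m.norm_frame_pos _ _).le
  change m'.norm _ w ^ (1 / (p.d : ℝ)) = _ * m.norm _ w ^ (1 / (p.d : ℝ))
  rw [Metric.norm_eq_exp_mul m m', Real.mul_rpow (Real.exp_pos _).le h0, ← Real.exp_mul,
    mul_one_div]

/-- The pulled back norm of a local frame. -/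
theorem rootPull_norm_frame (p : EndPair π L) (m : Metric π L) (x : Points π)
    (i : {i // Lies x.pt (L.U i)}) (k : {k // Lies (x.pt ≫ p.f) (L.U k)}) :
    (p.rootPull m).norm x (L.frame x.pt i) =
      (‖eval x.pt (U := L.U i.1 ⊓ p.f ⁻¹ᵁ (L.U k.1)) (i.2.inf k.2) (p.φ.u i.1 k.1).1‖ *
        m.norm (x.map p.f p.comm) (L.frame (x.map p.f p.comm).pt k)) ^ (1 / (p.d : ℝ)) := by
  let w : L.Fiber (x.map p.f p.comm).pt :=
    L.pullbackFiber p.f x.pt (p.φ.fiberMap x.pt (L.tpow p.d (L.frame x.pt i)))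
  have h2 : (L.tpow p.d (L.frame x.pt i)).1 i = 1 :=
    (congrArg (· ^ p.d) (L.frame_self x.pt i)).trans (one_pow _)
  have h := p.φ.fiberMap_apply x.pt (L.tpow p.d (L.frame x.pt i)) i ⟨k.1, k.2⟩
  rw [h2, mul_one] at h
  have h3 : m.norm (x.map p.f p.comm) w = ‖w.1 k‖ * _ := m.norm_eq (x.map p.f p.comm) w k
  have h4 : ‖w.1 k‖ = _ := congrArg (‖·‖) h
  rw [h4] at h3
  exact congrArg (· ^ (1 / (p.d : ℝ))) h3

/-- Where `x` lies in `U i` and `f(x)` in `U k`, the norm of the frame is a root of the absolute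
value of a regular unit times a continuous frame norm at `f(x)`. -/
theorem rootPull_isContinuous (p : EndPair π L) {m : Metric π L} (hm : m.IsContinuous) :
    (p.rootPull m).IsContinuous := by
  intro i
  refine continuous_iff_continuousAt.2 fun x => ?_
  obtain ⟨k, hk⟩ := L.idx (x.1.pt ≫ p.f)
  let W := L.U i ⊓ p.f ⁻¹ᵁ (L.U k)
  have hx : Lies x.1.pt W := x.2.inf hk
  have hU : ∀ {y : Points π}, Lies y.pt W → Lies (y.map p.f p.comm).pt (L.U k) :=
    fun h _ hq => (h hq).2
  let S : Set {x : Points π // Lies x.pt (L.U i)} := {y | Lies y.1.pt W}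
  have hS : IsOpen S := (Points.isOpen_lies W).preimage continuous_subtype_val
  refine ContinuousOn.continuousAt ?_ (hS.mem_nhds hx)
  rw [continuousOn_iff_continuous_domRestrict]
  have h1 : Continuous fun y : S => ‖eval y.1.1.pt (U := W) y.2 (p.φ.u i k).1‖ :=
    ((Points.continuous_eval (π := π) (U := W) (p.φ.u i k).1).comp
      ((continuous_subtype_val.comp continuous_subtype_val).subtype_mk
        fun y : S => y.2)).norm
  have h2 : Continuous fun y : S =>
      m.norm (y.1.1.map p.f p.comm) (L.frame (y.1.1.map p.f p.comm).pt ⟨k, hU y.2⟩) :=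
    (hm k).comp (((Points.continuous_map p.f p.comm).comp
      (continuous_subtype_val.comp continuous_subtype_val)).subtype_mk fun y : S => hU y.2)
  refine Continuous.congr ((h1.mul h2).rpow_const (p := 1 / (p.d : ℝ))
    fun _ => Or.inr (by positivity)) fun y => ?_
  exact (p.rootPull_norm_frame m y.1.1 ⟨i, y.1.2⟩ ⟨k, hU y.2⟩).symm

end EndPair

/-! ### The canonical metric -/

section Canonical

variable {X : Scheme.{u}} {π : X ⟶ Spec (.of K)} {L : LineBundle X}

/-- The terms of the series defining the logarithm of the canonical metric. -/
def canonicalTerm (m : Metric π L) : ℕ → (ℕ → EndPair π L) → Points π → ℝ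
  | 0, p, x => m.logRatio ((p 0).rootPull m) x
  | n + 1, p, x =>
    canonicalTerm m n (fun i => p (i + 1)) (x.map (p 0).f (p 0).comm) / ((p 0).d : ℝ)

/-- Each step of the recursion divides by a degree `≥ 2`. The induction runs over all sequences
because the recursion shifts `p`. -/
theorem abs_canonicalTerm_le {m : Metric π L} {C : ℝ} (n : ℕ) {p : ℕ → EndPair π L}
    (hp : ∀ i x, |m.logRatio ((p i).rootPull m) x| ≤ C) (x : Points π) :
    |canonicalTerm m n p x| ≤ C * (1 / 2) ^ n := by
  induction n generalizing p x with
  | zero => simpa [canonicalTerm] using hp 0 x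
  | succ n ih =>
    have h := ih (fun i => hp (i + 1)) (x.map (p 0).f (p 0).comm)
    have hd : (2 : ℝ) ≤ (p 0).d := by exact_mod_cast (p 0).two_le
    rw [canonicalTerm, abs_div, abs_of_pos (by linarith : (0 : ℝ) < (p 0).d), pow_succ, ← mul_assoc,
      mul_one_div]
    exact div_le_div₀ ((abs_nonneg _).trans h) h two_pos hd

theorem continuous_canonicalTerm {m : Metric π L} (hm : m.IsContinuous) (n : ℕ)
    (p : ℕ → EndPair π L) : Continuous (canonicalTerm m n p) := by
  induction n generalizing p with
  | zero => exact Metric.continuous_logRatio hm ((p 0).rootPull_isContinuous hm)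
  | succ n ih =>
    exact ((ih _).comp (Points.continuous_map (p 0).f (p 0).comm)).div_const _

/-- The logarithm of the canonical metric, relative to the metric `m`. -/
def canonicalLog (m : Metric π L) (p : ℕ → EndPair π L) (x : Points π) : ℝ :=
  ∑' n, canonicalTerm m n p x

theorem summable_canonicalTerm {m : Metric π L} {C : ℝ} {p : ℕ → EndPair π L}
    (hp : ∀ i x, |m.logRatio ((p i).rootPull m) x| ≤ C) (x : Points π) :
    Summable fun n => canonicalTerm m n p x :=
  Summable.of_norm_bounded (summable_geometric_two.mul_left C) fun n =>
    (Real.norm_eq_abs _).trans_le (abs_canonicalTerm_le n hp x)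

/-- The geometric series with ratio `1/2` sums to `2`, whence the constant in (i). -/
theorem abs_canonicalLog_le {m : Metric π L} {C : ℝ} {p : ℕ → EndPair π L}
    (hp : ∀ i x, |m.logRatio ((p i).rootPull m) x| ≤ C) (x : Points π) :
    |canonicalLog m p x| ≤ 2 * C := by
  have h := tsum_of_norm_bounded (hasSum_geometric_two.mul_left C) fun n =>
    (Real.norm_eq_abs _).trans_le (abs_canonicalTerm_le n hp x)
  rwa [mul_comm] at h

theorem continuous_canonicalLog {m : Metric π L} {C : ℝ} {p : ℕ → EndPair π L}
    (hp : ∀ i x, |m.logRatio ((p i).rootPull m) x| ≤ C) (hm : m.IsContinuous) :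
    Continuous (canonicalLog m p) :=
  continuous_tsum (fun n => continuous_canonicalTerm hm n p) (summable_geometric_two.mul_left C)
    fun n x => (Real.norm_eq_abs _).trans_le (abs_canonicalTerm_le n hp x)

/-- After the zeroth term is removed, the recursion makes the tail the series of the shifted
sequence at `f(x)`, divided by `d`. This is the logarithmic form of (ii). -/
theorem canonicalLog_eq {m : Metric π L} {C : ℝ} {p : ℕ → EndPair π L}
    (hp : ∀ i x, |m.logRatio ((p i).rootPull m) x| ≤ C) (x : Points π) :
    canonicalLog m p x = m.logRatio ((p 0).rootPull m) x +
      canonicalLog m (fun i => p (i + 1)) (x.map (p 0).f (p 0).comm) / (p 0).d := by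
  rw [canonicalLog, (summable_canonicalTerm hp x).tsum_eq_zero_add, canonicalLog, ← tsum_div_const]
  rfl

theorem abs_logRatio_le_of_mem {m : Metric π L} {p : ℕ → EndPair π L} (hp : p ∈ BoundedSeq m)
    (i : ℕ) (x : Points π) : |m.logRatio ((p i).rootPull m) x| ≤ (seqC m p).toReal := by
  have h : m.logSup ((p i).rootPull m) ≤ seqC m p := le_iSup (fun i => (p i).c m) i
  rw [← ENNReal.ofReal_toReal (lt_top_iff_ne_top.1 hp)] at h
  exact (Metric.logSup_le_ofReal_iff ENNReal.toReal_nonneg).1 h x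

theorem mem_boundedSeq_of_abs_le {m : Metric π L} {p : ℕ → EndPair π L} {C : ℝ}
    (h : ∀ i x, |m.logRatio ((p i).rootPull m) x| ≤ C) : p ∈ BoundedSeq m := by
  -- `C` may be negative when `X(K)` is empty.
  refine lt_of_le_of_lt (iSup_le fun i => ?_) (ENNReal.ofReal_lt_top (r := max C 0))
  exact (Metric.logSup_le_ofReal_iff (le_max_right _ _)).2 fun x => (h i x).trans (le_max_left _ _)

/-- The canonical metrics form an admissible family. -/
theorem exists_isAdmissibleFamily {m : Metric π L} (hm : m.IsBoundedContinuous)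
    (hc : m.IsContinuous) : ∃ h : BoundedSeq m → Metric π L, IsAdmissibleFamily m h := by
  refine ⟨fun p => m.twist (canonicalLog m p.1), fun p => ⟨⟨?_, ?_⟩, ?_⟩⟩
  · have hb := abs_logRatio_le_of_mem p.2
    exact hm.twist (continuous_canonicalLog hb hc) (abs_canonicalLog_le hb)
  · have hb := abs_logRatio_le_of_mem p.2
    rw [← ENNReal.ofReal_toReal (lt_top_iff_ne_top.1 p.2),
      show (2 : ℝ≥0∞) = ENNReal.ofReal 2 by simp, ← ENNReal.ofReal_mul zero_le_two]
    refine (Metric.logSup_le_ofReal_iff (by positivity)).2 fun x => ?_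
    rw [Metric.logRatio_twist]
    exact abs_canonicalLog_le hb x
  · refine (Metric.root_eq_iff (p.1 0).d_ne_zero).1 (Metric.eq_of_logRatio_eq_zero fun x => ?_)
    change Metric.logRatio _ ((p.1 0).rootPull (m.twist (canonicalLog m (shift p).1))) x = 0
    -- Pass from the twisted metric to `m`, then to `rootPull m`, then to `rootPull` of the shifted
    -- twist; the last two contributions add up to `canonicalLog m p`.
    rw [← Metric.logRatio_add _ m, Metric.logRatio_symm, Metric.logRatio_twist,
      canonicalLog_eq (abs_logRatio_le_of_mem p.2),
      ← Metric.logRatio_add m ((p.1 0).rootPull m) ((p.1 0).rootPull (m.twist _)),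
      EndPair.logRatio_rootPull, Metric.logRatio_twist]
    exact neg_add_cancel _

/-- Two families of metrics on sequences of pairs which satisfy the functional equation and are
at bounded distance on the orbit of a sequence under the shift agree. -/
theorem eq_of_functional_equation {C : ℝ} (h h' : ℕ → Metric π L) (p : ℕ → EndPair π L)
    (hh : ∀ n, (p n).rootPull (h (n + 1)) = h n) (hh' : ∀ n, (p n).rootPull (h' (n + 1)) = h' n)
    (hC : ∀ n x, |(h n).logRatio (h' n) x| ≤ C) (n : ℕ) : h' n = h n := by
  -- The estimate at `n` comes from the one at `n + 1`, so the initial bound must be uniform along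
  -- the orbit.
  have key : ∀ k n x, |(h n).logRatio (h' n) x| ≤ C * (1 / 2) ^ k := by
    intro k
    induction k with
    | zero => simpa using hC
    | succ k ih =>
      intro n x
      have hd : (2 : ℝ) ≤ (p n).d := by exact_mod_cast (p n).two_le
      have h1 := ih (n + 1) (x.map (p n).f (p n).comm)
      rw [← hh n, ← hh' n, EndPair.logRatio_rootPull, abs_div,
        abs_of_pos (by linarith : (0 : ℝ) < (p n).d), pow_succ, ← mul_assoc, mul_one_div]
      exact div_le_div₀ ((abs_nonneg _).trans h1) h1 two_pos hd
  refine Metric.eq_of_logRatio_eq_zero fun x => ?_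
  have hlim : Filter.Tendsto (fun k : ℕ => C * (1 / 2 : ℝ) ^ k) Filter.atTop (nhds (C * 0)) :=
    (tendsto_pow_atTop_nhds_zero_of_lt_one (by norm_num) (by norm_num)).const_mul C
  rw [mul_zero] at hlim
  exact abs_nonpos_iff.1 (ge_of_tendsto' hlim fun k => key k n x)

theorem IsAdmissibleFamily.abs_logRatio_le {m : Metric π L} {h : BoundedSeq m → Metric π L}
    (hh : IsAdmissibleFamily m h) (p : BoundedSeq m) {C : ℝ} (hC : seqC m p.1 ≤ ENNReal.ofReal C)
    (hC0 : 0 ≤ C) (x : Points π) : |m.logRatio (h p) x| ≤ 2 * C := by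
  refine (Metric.logSup_le_ofReal_iff (by positivity)).1 ((hh p).1.2.trans ?_) x
  rw [ENNReal.ofReal_mul zero_le_two]
  gcongr
  simp

/-- Admissible families for two metrics at bounded distance agree. -/
theorem IsAdmissibleFamily.eq {m m' : Metric π L} {B : ℝ} (hB : ∀ x, |m.logRatio m' x| ≤ B)
    {h : BoundedSeq m → Metric π L} {h' : BoundedSeq m' → Metric π L}
    (hh : IsAdmissibleFamily m h) (hh' : IsAdmissibleFamily m' h') (p : ℕ → EndPair π L)
    (hp : p ∈ BoundedSeq m) (hp' : p ∈ BoundedSeq m') : h' ⟨p, hp'⟩ = h ⟨p, hp⟩ := by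
  have le : ∀ (M : Metric π L) n, seqC M (fun i => p (i + n)) ≤ seqC M p := fun M n =>
    iSup_le fun i => le_iSup (fun i => (p i).c M) (i + n)
  have mem : ∀ (M : Metric π L), p ∈ BoundedSeq M → ∀ n, (fun i => p (i + n)) ∈ BoundedSeq M :=
    fun M hM n => (le M n).trans_lt hM
  have eqn : ∀ (M : Metric π L) (H : BoundedSeq M → Metric π L) (_ : IsAdmissibleFamily M H)
      (hM : p ∈ BoundedSeq M) (n : ℕ),
      (p n).rootPull (H ⟨_, mem M hM (n + 1)⟩) = H ⟨_, mem M hM n⟩ := by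
    intro M H hH hM n
    have h1 := (hH ⟨_, mem M hM n⟩).2
    have h2 := (Metric.root_eq_iff (EndPair.d_ne_zero _)).2 h1
    have h3 : shift ⟨_, mem M hM n⟩ = ⟨_, mem M hM (n + 1)⟩ := by
      refine Subtype.ext (funext fun i => ?_)
      change p (i + 1 + n) = p (i + (n + 1))
      rw [add_right_comm, add_assoc]
    rw [h3] at h2
    have h4 : (p (0 + n)).rootPull (H ⟨_, mem M hM (n + 1)⟩) = H ⟨_, mem M hM n⟩ := h2
    rwa [zero_add] at h4
  have bd : ∀ (M : Metric π L) (H : BoundedSeq M → Metric π L) (_ : IsAdmissibleFamily M H)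
      (hM : p ∈ BoundedSeq M) (n : ℕ) (x : Points π),
      |M.logRatio (H ⟨_, mem M hM n⟩) x| ≤ 2 * (seqC M p).toReal := by
    intro M H hH hM n x
    refine hH.abs_logRatio_le _ ?_ ENNReal.toReal_nonneg x
    rw [ENNReal.ofReal_toReal (lt_top_iff_ne_top.1 hM)]
    exact le M n
  -- The constant adds the three legs from `h` to `m`, to `m'`, to `h'`; shifting does not increase
  -- `seqC`, so it works for all `n`.
  refine eq_of_functional_equation (C := 2 * (seqC m p).toReal + (B + 2 * (seqC m' p).toReal))
    (fun n => h ⟨_, mem m hp n⟩) (fun n => h' ⟨_, mem m' hp' n⟩) p (eqn m h hh hp)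
    (eqn m' h' hh' hp') (fun n x => ?_) 0
  rw [← Metric.logRatio_add _ m, ← Metric.logRatio_add m m', Metric.logRatio_symm]
  refine (abs_add_le _ _).trans (add_le_add ?_ ((abs_add_le _ _).trans (add_le_add (hB x) ?_)))
  · rw [abs_neg]; exact bd m h hh hp n x
  · exact bd m' h' hh' hp' n x

/-- Go from `m'` to `m`, to `rootPull m`, to `rootPull m'`: the outer legs cost at most `B` each,
the last one because pulling back contracts. -/
theorem boundedSeq_subset {m m' : Metric π L} {B : ℝ} (hB : ∀ x, |m.logRatio m' x| ≤ B) :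
    BoundedSeq m ⊆ BoundedSeq m' := by
  intro p hp
  refine mem_boundedSeq_of_abs_le (C := B + ((seqC m p).toReal + B)) fun i x => ?_
  rw [← Metric.logRatio_add m' m, ← Metric.logRatio_add m ((p i).rootPull m),
    EndPair.logRatio_rootPull, Metric.logRatio_symm]
  refine (abs_add_le _ _).trans (add_le_add ?_ ((abs_add_le _ _).trans (add_le_add
    (abs_logRatio_le_of_mem hp i x) ?_)))
  · rw [abs_neg]; exact hB x
  · have hd : (2 : ℝ) ≤ (p i).d := by exact_mod_cast (p i).two_le
    rw [abs_div, abs_of_pos (by linarith : (0 : ℝ) < (p i).d)]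
    exact (div_le_self (abs_nonneg _) (by linarith)).trans (hB _)

end Canonical

/-! ### Bounded sets of rational points -/

section Bounded

variable {X : Scheme.{u}} {π : X ⟶ Spec (.of K)}

theorem lies_iff_mem {x : Spec (.of K) ⟶ X} {U : X.Opens} :
    Lies x U ↔ x (IsLocalRing.closedPoint K) ∈ U := by
  refine ⟨fun h => h trivial, fun h q _ => ?_⟩
  obtain rfl : q = IsLocalRing.closedPoint K :=
    Subsingleton.elim (α := PrimeSpectrum K) q _
  exact h

theorem lies_basicOpen_iff {x : Spec (.of K) ⟶ X} {U : X.Opens} (h : Lies x U) (s : Γ(X, U)) :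
    Lies x (X.basicOpen s) ↔ eval x h s ≠ 0 := by
  constructor
  · intro h'
    have hu : IsUnit (res (X.basicOpen_le s) s) := RingedSpace.isUnit_res_basicOpen _ s
    have := (hu.map (eval x h')).ne_zero
    rwa [eval_res] at this
  · intro h'
    -- A nonzero value in the field `K` is a unit, so the pulled back function is invertible on all
    -- of `Spec K`.
    have hu : IsUnit ((x.appLE U ⊤ h).hom s) := by
      have h2 : IsUnit ((Scheme.ΓSpecIso (.of K)).hom.hom ((x.appLE U ⊤ h).hom s)) :=
        isUnit_iff_ne_zero.2 h'
      have h3 := h2.map (Scheme.ΓSpecIso (.of K)).inv.hom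
      rwa [← CommRingCat.comp_apply, Iso.hom_inv_id, CommRingCat.id_apply] at h3
    have h4 := Scheme.preimage_basicOpen x s
    have h5 : (Spec (.of K)).basicOpen ((x.appLE U ⊤ h).hom s) = ⊤ := by
      rw [Scheme.basicOpen_of_isUnit _ hu]
    have h6 : (Spec (.of K)).basicOpen ((x.appLE U ⊤ h).hom s) ≤
        (Spec (.of K)).basicOpen ((x.app U).hom s) := by
      have h7 : (x.appLE U ⊤ h).hom s =
          ((Spec (.of K)).presheaf.map (homOfLE h).op).hom ((x.app U).hom s) := rfl
      rw [h7]
      exact (Scheme.basicOpen_res _ _ _).trans_le inf_le_right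
    rw [h5, ← h4] at h6
    exact h6

/-- A set of rational points of `V` is bounded in `V` if all regular functions on `V` are bounded
on it. -/
structure BoundedIn (V : X.Opens) (E : Set (Points π)) : Prop where
  lies : ∀ x ∈ E, Lies x.pt V
  bounded : ∀ s : Γ(X, V), ∃ C, ∀ x ∈ E, ∀ h : Lies x.pt V, ‖eval x.pt h s‖ ≤ C

theorem BoundedIn.exists_pos {V : X.Opens} {E : Set (Points π)} (hE : BoundedIn V E)
    (s : Γ(X, V)) : ∃ C, 0 < C ∧ ∀ x ∈ E, ∀ h : Lies x.pt V, ‖eval x.pt h s‖ ≤ C := by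
  obtain ⟨C, hC⟩ := hE.bounded s
  exact ⟨max C 1, by positivity, fun x hx h => (hC x hx h).trans (le_max_left _ _)⟩

/-- The functions which are bounded on a set of rational points form a subring. -/
def boundedSubring (V : X.Opens) (E : Set (Points π)) : Subring Γ(X, V) where
  carrier := {s | ∃ C, ∀ x ∈ E, ∀ h : Lies x.pt V, ‖eval x.pt h s‖ ≤ C}
  mul_mem' := by
    rintro a b ⟨C, hC⟩ ⟨D, hD⟩
    refine ⟨C * D, fun x hx h => ?_⟩
    rw [map_mul, norm_mul]
    exact mul_le_mul (hC x hx h) (hD x hx h) (norm_nonneg _) ((norm_nonneg _).trans (hC x hx h))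
  one_mem' := ⟨1, fun x _ h => by simp⟩
  add_mem' := by
    rintro a b ⟨C, hC⟩ ⟨D, hD⟩
    refine ⟨C + D, fun x hx h => ?_⟩
    rw [map_add]
    exact (norm_add_le _ _).trans (add_le_add (hC x hx h) (hD x hx h))
  zero_mem' := ⟨0, fun x _ h => by simp⟩
  neg_mem' := by
    rintro a ⟨C, hC⟩
    exact ⟨C, fun x hx h => by rw [map_neg, norm_neg]; exact hC x hx h⟩

/-- A unit on a neighbourhood of a bounded set has bounded logarithm. -/
theorem BoundedIn.exists_abs_log_le {V : X.Opens} {E : Set (Points π)} (hE : BoundedIn V E)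
    (s : (Γ(X, V))ˣ) :
    ∃ C, ∀ x ∈ E, ∀ h : Lies x.pt V, |Real.log ‖eval x.pt h s.1‖| ≤ C := by
  obtain ⟨C, hC, h1⟩ := hE.exists_pos s.1
  -- An upper bound for the inverse is a lower bound for the unit.
  obtain ⟨D, hD, h2⟩ := hE.exists_pos s⁻¹.1
  refine ⟨max (Real.log C) (Real.log D), fun x hx h => ?_⟩
  have h0 : 0 < ‖eval x.pt h s.1‖ := norm_pos_iff.2 (LineBundle.eval_unit_ne_zero h s)
  have h0' : 0 < ‖eval x.pt h s⁻¹.1‖ := norm_pos_iff.2 (LineBundle.eval_unit_ne_zero h s⁻¹)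
  have h3 : Real.log ‖eval x.pt h s⁻¹.1‖ = -Real.log ‖eval x.pt h s.1‖ := by
    have : ‖eval x.pt h s.1‖ * ‖eval x.pt h s⁻¹.1‖ = 1 := by
      rw [← norm_mul, ← map_mul, Units.mul_inv, map_one, norm_one]
    rw [← Real.log_inv, eq_inv_of_mul_eq_one_right this]
  refine abs_le'.2 ⟨(Real.log_le_log h0 (h1 x hx h)).trans (le_max_left _ _), ?_⟩
  rw [← h3]
  exact (Real.log_le_log h0' (h2 x hx h)).trans (le_max_right _ _)

/-- Functions on the basic open set are fractions `b / g ^ n`; the lower bound on `g` controls the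
denominator. -/
theorem BoundedIn.basicOpen {V : X.Opens} (hV : IsAffineOpen V) {E : Set (Points π)}
    (hE : BoundedIn V E) (g : Γ(X, V)) {δ : ℝ} (hδ : 0 < δ) :
    BoundedIn (X.basicOpen g) {x ∈ E | ∀ h : Lies x.pt V, δ ≤ ‖eval x.pt h g‖} := by
  have hL : ∀ x ∈ {x ∈ E | ∀ h : Lies x.pt V, δ ≤ ‖eval x.pt h g‖},
      Lies x.pt (X.basicOpen g) := fun x hx =>
    (lies_basicOpen_iff (hE.lies x hx.1) g).2
      (norm_pos_iff.1 (hδ.trans_le (hx.2 (hE.lies x hx.1))))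
  refine ⟨hL, fun s => ?_⟩
  have := hV.isLocalization_basicOpen g
  obtain ⟨⟨b, ⟨_, n, rfl⟩⟩, hb⟩ := IsLocalization.surj (Submonoid.powers g) s
  obtain ⟨C, hC⟩ := hE.bounded b
  refine ⟨C / δ ^ n, fun x hx h => ?_⟩
  have hV' := hE.lies x hx.1
  have key : eval x.pt h s * eval x.pt hV' g ^ n = eval x.pt hV' b := by
    have h2 : s * res (X.basicOpen_le g) (g ^ n) = res (X.basicOpen_le g) b := hb
    have := congrArg (eval x.pt h) h2
    rwa [map_mul, eval_res, eval_res, map_pow] at this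
  rw [le_div_iff₀ (pow_pos hδ n)]
  calc ‖eval x.pt h s‖ * δ ^ n ≤ ‖eval x.pt h s‖ * ‖eval x.pt hV' g‖ ^ n := by
        gcongr
        exact hx.2 hV'
    _ = ‖eval x.pt hV' b‖ := by rw [← norm_pow, ← norm_mul, key]
    _ ≤ C := hC x hx.1 hV'

/-- A bounded set in an affine open `V` is a finite union of bounded sets in affine open subsets of
`V` subordinate to a given open cover. -/
theorem BoundedIn.exists_refinement {V : X.Opens} (hV : IsAffineOpen V) {E : Set (Points π)}
    (hE : BoundedIn V E) {ι : Type*} (U : ι → X.Opens) (hU : ⨆ i, U i = ⊤) :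
    ∃ (t : Finset Γ(X, V)) (F : Γ(X, V) → Set (Points π)),
      (∀ g ∈ t, (∃ i, X.basicOpen g ≤ U i) ∧ BoundedIn (X.basicOpen g) (F g)) ∧
        ∀ x ∈ E, ∃ g ∈ t, x ∈ F g := by
  let T : Set Γ(X, V) := {g | ∃ i, X.basicOpen g ≤ U i}
  -- Basic open sets form a basis of `V`, so those subordinate to the cover already cover `V`.
  have hT : Ideal.span T = ⊤ := by
    refine hV.self_le_iSup_basicOpen_iff.1 fun p hp => ?_
    have hp' : p ∈ ⨆ i, U i := by rw [hU]; trivial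
    obtain ⟨i, hi⟩ := Opens.mem_iSup.1 hp'
    obtain ⟨g, hg, hpg⟩ := hV.exists_basicOpen_le ⟨p, hi⟩ hp
    exact Opens.mem_iSup.2 ⟨⟨g, i, hg⟩, hpg⟩
  obtain ⟨t, htT, ht⟩ := (Ideal.span_eq_top_iff_finite T).1 hT
  have h1 : (1 : Γ(X, V)) ∈ Ideal.span (t : Set Γ(X, V)) := by rw [ht]; trivial
  obtain ⟨c, hc⟩ := Submodule.mem_span_finset'.1 h1
  choose C hC0 hC using fun g : t => hE.exists_pos (c g)
  -- From `1 = ∑ c g * g`, if all `g` were smaller than `δ` at a point, then `1 ≤ δ * ∑ C g < 1`.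
  let δ : ℝ := 1 / (1 + ∑ g, C g)
  have hS : 0 ≤ ∑ g, C g := Finset.sum_nonneg fun g _ => (hC0 g).le
  have hδ : 0 < δ := by positivity
  refine ⟨t, fun g => {x ∈ E | ∀ h : Lies x.pt V, δ ≤ ‖eval x.pt h g‖},
    fun g hg => ⟨htT hg, hE.basicOpen hV g hδ⟩, fun x hx => ?_⟩
  by_contra! hcon
  have hx' := hE.lies x hx
  have hlt : ∀ g ∈ t, ‖eval x.pt hx' g‖ < δ := by
    intro g hg
    by_contra! h
    exact hcon g hg ⟨hx, fun _ => h⟩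
  have h2 : (1 : ℝ) ≤ ∑ g : t, C g * δ := by
    calc (1 : ℝ) = ‖eval x.pt hx' 1‖ := by rw [map_one, norm_one]
      _ = ‖∑ g : t, eval x.pt hx' (c g) * eval x.pt hx' g.1‖ := by
        rw [← hc, map_sum]
        simp only [smul_eq_mul, map_mul]
      _ ≤ ∑ g : t, ‖eval x.pt hx' (c g) * eval x.pt hx' g.1‖ := norm_sum_le _ _
      _ ≤ ∑ g : t, C g * δ := by
        refine Finset.sum_le_sum fun g _ => ?_
        rw [norm_mul]
        exact mul_le_mul (hC g x hx hx') (hlt g.1 g.2).le (norm_nonneg _) (hC0 g).le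
  rw [← Finset.sum_mul, mul_one_div, le_div_iff₀ (by positivity)] at h2
  linarith

end Bounded

/-! ### Rational points of projective space -/

section Projective

attribute [local instance] MvPolynomial.gradedAlgebra

open HomogeneousLocalization

/-! ### Degree-zero fractions -/

section Away

variable {σ A : Type*} [CommRing A] [SetLike σ A] [AddSubgroupClass σ A] {𝒜 : ℕ → σ}
  [GradedRing 𝒜] {f g c : A}

theorem away_mk_self (hf : f ∈ 𝒜 1) (hf' : f ∈ 𝒜 (1 • 1)) : Away.mk 𝒜 hf 1 f hf' = 1 := by
  apply HomogeneousLocalization.val_injective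
  rw [Away.val_mk, HomogeneousLocalization.val_one]
  convert Localization.mk_self (⟨f ^ 1, 1, rfl⟩ : Submonoid.powers f) using 1
  simp only [pow_one]

theorem away_mk_prod {ι : Type*} [Fintype ι] (hf : f ∈ 𝒜 1) (v : ι → A)
    (hv : ∀ i, v i ∈ 𝒜 (1 • 1)) (a : ℕ) (k : ι → ℕ) (hk : ∑ i, k i = a)
    (h : ∏ i, v i ^ k i ∈ 𝒜 (a • 1)) :
    Away.mk 𝒜 hf a (∏ i, v i ^ k i) h = ∏ i, Away.mk 𝒜 hf 1 (v i) (hv i) ^ k i := by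
  apply HomogeneousLocalization.val_injective
  change _ = algebraMap (Away 𝒜 f) (Localization.Away f) (∏ i, _)
  simp only [map_prod, map_pow, HomogeneousLocalization.algebraMap_apply, Away.val_mk,
    Localization.mk_pow, Localization.mk_prod]
  refine congrArg (Localization.mk _) (Subtype.ext ?_)
  simp [← hk, Finset.prod_pow_eq_pow_sum]

/-- The change of charts `(c / g) * (g / f) = c / f` on the overlap. -/
theorem awayMap_mk_mul (hf : f ∈ 𝒜 1) (hg : g ∈ 𝒜 1) (hg' : g ∈ 𝒜 (1 • 1))
    (hc : c ∈ 𝒜 (1 • 1)) :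
    awayMap 𝒜 hf (mul_comm f g) (Away.mk 𝒜 hg 1 c hc) *
      awayMap 𝒜 hg (rfl : f * g = f * g) (Away.mk 𝒜 hf 1 g hg') =
        awayMap 𝒜 hg rfl (Away.mk 𝒜 hf 1 c hc) := by
  apply HomogeneousLocalization.val_injective
  rw [HomogeneousLocalization.val_mul, awayMap_mk, awayMap_mk, awayMap_mk, Away.val_mk,
    Away.val_mk, Away.val_mk, Localization.mk_mul, Localization.mk_eq_mk_iff,
    Localization.r_iff_exists]
  refine ⟨1, ?_⟩
  simp only [pow_one, OneMemClass.coe_one, one_mul, Submonoid.coe_mul]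
  ring

end Away

variable {n : ℕ}

theorem X_mem (A : Type u) [CommRing A] (a : Fin (n + 1)) :
    (MvPolynomial.X a : MvPolynomial (Fin (n + 1)) A) ∈
      MvPolynomial.homogeneousSubmodule (Fin (n + 1)) A 1 :=
  MvPolynomial.isHomogeneous_X A a

theorem algebraMap_zero_surjective (A : Type u) [CommRing A] :
    Function.Surjective
      (algebraMap A (MvPolynomial.homogeneousSubmodule (Fin (n + 1)) A 0)) := by
  rintro ⟨z, hz⟩
  refine ⟨MvPolynomial.coeff 0 z, Subtype.ext ?_⟩
  exact (MvPolynomial.totalDegree_eq_zero_iff_eq_C.1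
    (Nat.le_zero.1 (MvPolynomial.IsHomogeneous.totalDegree_le hz))).symm

theorem adjoin_range_X (A : Type u) [CommRing A] :
    Algebra.adjoin (MvPolynomial.homogeneousSubmodule (Fin (n + 1)) A 0)
      (Set.range (MvPolynomial.X : Fin (n + 1) → MvPolynomial (Fin (n + 1)) A)) = ⊤ := by
  refine top_le_iff.1 fun z _ => ?_
  have hz : z ∈ Algebra.adjoin A
      (Set.range (MvPolynomial.X : Fin (n + 1) → MvPolynomial (Fin (n + 1)) A)) := by
    rw [MvPolynomial.adjoin_range_X]; trivial
  induction hz using Algebra.adjoin_induction with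
  | mem x hx => exact Algebra.subset_adjoin hx
  | algebraMap r =>
    exact Subalgebra.algebraMap_mem _
      (algebraMap A (MvPolynomial.homogeneousSubmodule (Fin (n + 1)) A 0) r)
  | add x y _ _ hx hy => exact add_mem (hx trivial) (hy trivial)
  | mul x y _ _ hx hy => exact mul_mem (hx trivial) (hy trivial)

/-- The function `T_c / T_b` on the chart `T_b ≠ 0` of projective space. -/
def chartCoord (A : Type u) [CommRing A] (b c : Fin (n + 1)) :
    Away (MvPolynomial.homogeneousSubmodule (Fin (n + 1)) A) (MvPolynomial.X b) :=
  Away.mk _ (X_mem A b) 1 (MvPolynomial.X c) (X_mem A c)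

/-- The inclusion of the chart `T_b ≠ 0` in projective space. -/
abbrev chart (A : Type u) [CommRing A] (b : Fin (n + 1)) :
    Spec (.of (Away (MvPolynomial.homogeneousSubmodule (Fin (n + 1)) A) (MvPolynomial.X b))) ⟶
      ProjSpace n A :=
  Proj.awayι _ (MvPolynomial.X b) (X_mem A b) one_pos

/-- Functions on the chart are `K`-linear combinations of monomials in the coordinates, and each
monomial is at most one. The bound depends on the coefficients only, not on the point `ρ`. -/
theorem exists_bound_of_coord_le {b : Fin (n + 1)}
    (z : Away (MvPolynomial.homogeneousSubmodule (Fin (n + 1)) K) (MvPolynomial.X b)) :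
    ∃ C, ∀ ρ : Away (MvPolynomial.homogeneousSubmodule (Fin (n + 1)) K) (MvPolynomial.X b) →+* K,
      (∀ a, ρ (fromZeroRingHom _ _ (algebraMap K _ a)) = a) →
      (∀ c, ‖ρ (chartCoord K b c)‖ ≤ 1) → ‖ρ z‖ ≤ C := by
  have hz : z ∈ (⊤ : Submodule (MvPolynomial.homogeneousSubmodule (Fin (n + 1)) K 0) _) := trivial
  rw [← Away.span_mk_prod_pow_eq_top (X_mem K b) MvPolynomial.X (adjoin_range_X K) (fun _ => 1)
    (X_mem K)] at hz
  induction hz using Submodule.span_induction with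
  | mem x hx =>
    obtain ⟨a, ai, hai, rfl⟩ := hx
    refine ⟨1, fun ρ _ h => ?_⟩
    have : Away.mk _ (X_mem K b) a (∏ i, (MvPolynomial.X i : MvPolynomial (Fin (n + 1)) K) ^ ai i)
        (hai ▸ SetLike.prod_pow_mem_graded _ _ _ _ fun i _ ↦ X_mem K i) =
          ∏ i, chartCoord K b i ^ ai i :=
      away_mk_prod _ _ _ _ _ (by simpa using hai) _
    rw [this, map_prod, norm_prod]
    refine Finset.prod_le_one (fun _ _ => norm_nonneg _) fun i _ => ?_
    rw [map_pow, norm_pow]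
    exact pow_le_one₀ (norm_nonneg _) (h i)
  | zero => exact ⟨0, fun ρ _ _ => by simp⟩
  | add x y _ _ hx hy =>
    obtain ⟨C, hC⟩ := hx
    obtain ⟨D, hD⟩ := hy
    refine ⟨C + D, fun ρ h h' => ?_⟩
    rw [map_add]
    exact (norm_add_le _ _).trans (add_le_add (hC ρ h h') (hD ρ h h'))
  | smul a x _ hx =>
    obtain ⟨C, hC⟩ := hx
    obtain ⟨r, rfl⟩ := algebraMap_zero_surjective K a
    refine ⟨‖r‖ * C, fun ρ h h' => ?_⟩
    rw [Algebra.smul_def, map_mul, norm_mul]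
    refine mul_le_mul_of_nonneg_left (hC ρ h h') (norm_nonneg _) |>.trans' (le_of_eq ?_)
    congr 2
    exact h r

/-- Every rational point of projective space lies in a chart in which its coordinates are bounded
by one. -/
theorem exists_chart_coord_le (x : Spec (.of K) ⟶ ProjSpace n K) :
    ∃ (b : Fin (n + 1))
      (ρ : Away (MvPolynomial.homogeneousSubmodule (Fin (n + 1)) K) (MvPolynomial.X b) →+* K),
      Spec.map (CommRingCat.ofHom ρ) ≫ chart K b = x ∧ ∀ c, ‖ρ (chartCoord K b c)‖ ≤ 1 := by
  let 𝒜 := MvPolynomial.homogeneousSubmodule (Fin (n + 1)) K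
  have hcov := Proj.iSup_basicOpen_eq_top' 𝒜 MvPolynomial.X (fun i => ⟨1, X_mem K i⟩)
    (adjoin_range_X K)
  have hx : x (IsLocalRing.closedPoint K) ∈ ⨆ i, Proj.basicOpen 𝒜 (MvPolynomial.X i) := by
    rw [hcov]; trivial
  obtain ⟨a, ha⟩ := Opens.mem_iSup.1 hx
  have ha : Lies x (Proj.basicOpen 𝒜 (MvPolynomial.X a)) := lies_iff_mem.2 ha
  have hr : Set.range x ⊆ Set.range (chart K a) := by
    rintro _ ⟨q, rfl⟩
    have : x q ∈ (chart K a).opensRange := by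
      rw [Proj.opensRange_awayι]
      exact ha trivial
    exact this
  obtain ⟨ρ, hρ⟩ : ∃ ρ : Away 𝒜 (MvPolynomial.X a) →+* K,
      Spec.map (CommRingCat.ofHom ρ) ≫ chart K a = x := by
    refine ⟨(Spec.preimage (IsOpenImmersion.lift (chart K a) x hr)).hom, ?_⟩
    rw [CommRingCat.ofHom_hom, Spec.map_preimage, IsOpenImmersion.lift_fac]
  -- Starting from any chart `a` containing the point, pass to the chart of its largest coordinate,
  -- which is nonzero since the `a`-th coordinate is one.
  obtain ⟨b, -, hb⟩ := Finset.exists_max_image Finset.univ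
    (fun c => ‖ρ (chartCoord K a c)‖) Finset.univ_nonempty
  have h1 : chartCoord K a a = 1 := away_mk_self _ _
  have hb0 : ρ (chartCoord K a b) ≠ 0 := by
    have := hb a (Finset.mem_univ _)
    rw [h1, map_one, norm_one] at this
    exact norm_pos_iff.1 (one_pos.trans_le this)
  let f := awayMap 𝒜 (X_mem K b) (rfl : (MvPolynomial.X a * MvPolynomial.X b :
    MvPolynomial (Fin (n + 1)) K) = MvPolynomial.X a * MvPolynomial.X b)
  let g := awayMap 𝒜 (X_mem K a) (mul_comm _ _ : (MvPolynomial.X a * MvPolynomial.X b :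
    MvPolynomial (Fin (n + 1)) K) = MvPolynomial.X b * MvPolynomial.X a)
  -- The overlap of the charts is the localization of chart `a` at `T_b / T_a`, on which `ρ` does
  -- not vanish.
  obtain ⟨σ, hσ⟩ : ∃ σ : Away 𝒜 (MvPolynomial.X a * MvPolynomial.X b) →+* K, σ.comp f = ρ := by
    let := f.toAlgebra
    have : IsLocalization.Away (Away.isLocalizationElem (X_mem K a) (X_mem K b))
        (Away 𝒜 (MvPolynomial.X a * MvPolynomial.X b)) :=
      Away.isLocalization_mul (X_mem K a) (X_mem K b) rfl one_ne_zero
    have he : Away.isLocalizationElem (X_mem K a) (X_mem K b) = chartCoord K a b := by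
      simp [Away.isLocalizationElem, chartCoord]
    have hu : IsUnit (ρ (Away.isLocalizationElem (X_mem K a) (X_mem K b))) := by
      rw [he]; exact isUnit_iff_ne_zero.2 hb0
    exact ⟨IsLocalization.Away.lift _ hu, IsLocalization.Away.lift_comp _ hu⟩
  refine ⟨b, σ.comp g, ?_, fun c => ?_⟩
  · rw [CommRingCat.ofHom_comp, Spec.map_comp, Category.assoc, Proj.SpecMap_awayMap_awayι, ← hρ,
      ← hσ, CommRingCat.ofHom_comp, Spec.map_comp, Category.assoc, Proj.SpecMap_awayMap_awayι]
  · have hm : g (chartCoord K b c) * f (chartCoord K a b) = f (chartCoord K a c) :=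
      awayMap_mk_mul _ _ _ _
    have := congrArg σ hm
    rw [map_mul, ← RingHom.comp_apply σ f, ← RingHom.comp_apply σ f, hσ] at this
    have h2 := hb c (Finset.mem_univ _)
    rw [← this, norm_mul] at h2
    exact le_of_mul_le_mul_right (h2.trans_eq (one_mul _).symm) (norm_pos_iff.2 hb0)

/-- `Proj` is proper over its degree-zero part by finite generation, and the degree-zero part is a
quotient of `A`, giving a closed immersion. -/
theorem isProper_toSpec (n : ℕ) (A : Type u) [CommRing A] : IsProper (ProjSpace.toSpec n A) := by
  have : Algebra.FiniteType (MvPolynomial.homogeneousSubmodule (Fin (n + 1)) A 0)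
      (MvPolynomial (Fin (n + 1)) A) := by
    classical
    exact ⟨⟨Finset.univ.image MvPolynomial.X, by simpa using adjoin_range_X A⟩⟩
  have : IsClosedImmersion (Spec.map (CommRingCat.ofHom
      (algebraMap A (MvPolynomial.homogeneousSubmodule (Fin (n + 1)) A 0)))) :=
    IsClosedImmersion.spec_of_surjective _ (algebraMap_zero_surjective A)
  rw [ProjSpace.toSpec]
  infer_instance

theorem IsProjectiveOver.isProper {X : Scheme.{u}} {A : Type u} [CommRing A]
    {π : X ⟶ Spec (.of A)} (h : IsProjectiveOver π) : IsProper π := by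
  obtain ⟨n, i, hi, rfl⟩ := h
  have := isProper_toSpec n A
  infer_instance

theorem chart_algebraMap {b : Fin (n + 1)}
    (ρ : Away (MvPolynomial.homogeneousSubmodule (Fin (n + 1)) K) (MvPolynomial.X b) →+* K)
    (h : Spec.map (CommRingCat.ofHom ρ) ≫ chart K b ≫ ProjSpace.toSpec n K = 𝟙 _) (a : K) :
    ρ (fromZeroRingHom _ _ (algebraMap K _ a)) = a := by
  rw [ProjSpace.toSpec, Proj.awayι_toSpecZero_assoc, ← Spec.map_comp, ← Spec.map_comp,
    ← Spec.map_id] at h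
  exact congrArg (fun f => f.hom a) (Spec.map_injective h)

theorem eval_specMap_comp {X : Scheme.{u}} {R : Type u} [CommRing R] (ρ : R →+* K)
    (f : Spec (.of R) ⟶ X) {x : Spec (.of K) ⟶ X} (hx : Spec.map (CommRingCat.ofHom ρ) ≫ f = x)
    {U : X.Opens} (hU : ⊤ ≤ f ⁻¹ᵁ U) (h : Lies x U) (s : Γ(X, U)) :
    eval x h s = ρ ((Scheme.ΓSpecIso (.of R)).hom.hom ((f.appLE U ⊤ hU).hom s)) := by
  subst hx
  have h1 := Scheme.Hom.appLE_comp_appLE (Spec.map (CommRingCat.ofHom ρ)) f U ⊤ ⊤ hU le_top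
  have h2 := Scheme.ΓSpecIso_naturality (CommRingCat.ofHom ρ)
  rw [eval, ← h1, Category.assoc]
  have h3 : (Spec.map (CommRingCat.ofHom ρ)).appLE ⊤ ⊤ le_top ≫ (Scheme.ΓSpecIso (.of K)).hom =
      (Scheme.ΓSpecIso (.of R)).hom ≫ CommRingCat.ofHom ρ := by
    rw [← h2, Scheme.Hom.appTop, Scheme.Hom.app_eq_appLE]
    rfl
  rw [h3]
  rfl

/-- The rational points of a projective variety are covered by finitely many bounded subsets of
affine open subvarieties. -/
theorem IsProjectiveOver.exists_bounded_cover {X : Scheme.{u}} {π : X ⟶ Spec (.of K)}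
    (hπ : IsProjectiveOver π) :
    ∃ (n : ℕ) (V : Fin n → X.Opens) (E : Fin n → Set (Points π)),
      (∀ a, IsAffineOpen (V a) ∧ BoundedIn (V a) (E a)) ∧ ∀ x, ∃ a, x ∈ E a := by
  obtain ⟨n, i, hi, rfl⟩ := hπ
  have haff : ∀ b : Fin (n + 1), IsAffineOpen (chart K b).opensRange := fun b =>
    isAffineOpen_opensRange _
  refine ⟨n + 1, fun b => i ⁻¹ᵁ (chart K b).opensRange, fun b => {x | ∃ ρ,
    Spec.map (CommRingCat.ofHom ρ) ≫ chart K b = x.pt ≫ i ∧ ∀ c, ‖ρ (chartCoord K b c)‖ ≤ 1},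
    fun b => ⟨(haff b).preimage i, ⟨?_, fun s => ?_⟩⟩, fun x => ?_⟩
  · rintro x ⟨ρ, hρ, -⟩ q -
    change (x.pt ≫ i) q ∈ (chart K b).opensRange
    rw [← hρ]
    exact ⟨_, rfl⟩
  · obtain ⟨s, rfl⟩ := Scheme.Hom.app_surjective i _ (haff b) s
    -- The function now comes from the chart of projective space, since `i` is a closed immersion,
    -- so its bound may be found there.
    have hU : ⊤ ≤ chart K b ⁻¹ᵁ (chart K b).opensRange := fun q _ => ⟨q, rfl⟩
    obtain ⟨C, hC⟩ := exists_bound_of_coord_le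
      ((Scheme.ΓSpecIso _).hom.hom (((chart K b).appLE _ ⊤ hU).hom s))
    refine ⟨C, ?_⟩
    rintro x ⟨ρ, hρ, hc⟩ h
    have h1 := (eval_pull i x.pt (U := (chart K b).opensRange) h h s).trans
      (eval_specMap_comp ρ (chart K b) hρ hU h s)
    refine (congrArg (‖·‖) h1).trans_le (hC ρ (chart_algebraMap ρ ?_) hc)
    rw [reassoc_of% hρ, x.comm]
  · obtain ⟨b, ρ, hρ, hc⟩ := exists_chart_coord_le (x.pt ≫ i)
    exact ⟨b, ρ, hρ, hc⟩

end Projective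

/-! ### Distance between locally bounded metrics -/

/-- Two metrics which are locally bounded are at bounded distance. -/
theorem Metric.IsLocallyBounded.exists_abs_logRatio_le {X : Scheme.{u}} {π : X ⟶ Spec (.of K)}
    (hπ : IsProjectiveOver π) {L : LineBundle X} {m m' : Metric π L} (hm : m.IsLocallyBounded)
    (hm' : m'.IsLocallyBounded) : ∃ B, ∀ x, |m.logRatio m' x| ≤ B := by
  obtain ⟨n, V, E, hV, hE⟩ := hπ.exists_bounded_cover
  have key : ∀ a, ∃ B, ∀ x ∈ E a, |m.logRatio m' x| ≤ B := by
    intro a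
    obtain ⟨t, F, hF, hcov⟩ := (hV a).2.exists_refinement (hV a).1 L.U L.cover
    have hg : ∀ g : t, ∃ B, ∀ x ∈ F g, |m.logRatio m' x| ≤ B := by
      rintro ⟨g, hg⟩
      obtain ⟨⟨i, hi⟩, hb⟩ := hF g hg
      have hA := (hV a).1.basicOpen g
      have hb' : ∀ s : Γ(X, X.basicOpen g), ∃ C,
          ∀ x ∈ {x : {x : Points π // Lies x.pt (X.basicOpen g)} | x.1 ∈ F g},
            ‖eval x.1.pt x.2 s‖ ≤ C := fun s => by
        obtain ⟨C, hC⟩ := hb.bounded s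
        exact ⟨C, fun x hx => hC x.1 hx x.2⟩
      obtain ⟨C, hC⟩ := hm i _ hi hA _ hb'
      obtain ⟨C', hC'⟩ := hm' i _ hi hA _ hb'
      refine ⟨C' + C, fun x hx => ?_⟩
      have hx' := hb.lies x hx
      rw [Metric.logRatio_eq_sub_of_frame m m' x ⟨i, hx'.mono hi⟩]
      exact (abs_sub _ _).trans (add_le_add (hC' ⟨x, hx'⟩ hx) (hC ⟨x, hx'⟩ hx))
    choose B hB using hg
    refine ⟨∑ g, |B g|, fun x hx => ?_⟩
    obtain ⟨g, hg, hx'⟩ := hcov x hx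
    exact ((hB ⟨g, hg⟩ x hx').trans (le_abs_self _)).trans
      (Finset.single_le_sum (f := fun g => |B g|) (fun _ _ => abs_nonneg _) (Finset.mem_univ _))
  choose B hB using key
  refine ⟨∑ a, |B a|, fun x => ?_⟩
  obtain ⟨a, hx⟩ := hE x
  exact ((hB a x hx).trans (le_abs_self _)).trans
    (Finset.single_le_sum (f := fun a => |B a|) (fun _ _ => abs_nonneg _) (Finset.mem_univ _))

/-! ### Generation of rings of functions -/

section Generation

open Limits

/-- If `Z → V ×_S W` is a closed immersion, where `V`, `W` and `S` are affine, the functions on `Z`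
are generated by those on `V` and `W`. -/
theorem subring_eq_top_of_isClosedImmersion {Z V W S : Scheme.{u}} [IsAffine V] [IsAffine W]
    [IsAffine S] {p : V ⟶ S} {q : W ⟶ S} (f : Z ⟶ V) (g : Z ⟶ W) (h : f ≫ p = g ≫ q)
    [IsClosedImmersion (pullback.lift f g h)] (T : Subring Γ(Z, ⊤))
    (hf : f.appTop.hom.range ≤ T) (hg : g.appTop.hom.range ≤ T) : T = ⊤ := by
  have hP := isPushout_appTop_of_isPullback (IsPullback.of_hasPullback p q)
  let T' : Subring Γ(pullback p q, ⊤) := T.comap (pullback.lift f g h).appTop.hom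
  have h1 : ∀ a, (pullback.fst p q).appTop.hom a ∈ T' := fun a => by
    refine hf ⟨a, ?_⟩
    rw [← CommRingCat.comp_apply, ← Scheme.Hom.comp_appTop, pullback.lift_fst]
  have h2 : ∀ a, (pullback.snd p q).appTop.hom a ∈ T' := fun a => by
    refine hg ⟨a, ?_⟩
    rw [← CommRingCat.comp_apply, ← Scheme.Hom.comp_appTop, pullback.lift_snd]
  let i1 : Γ(V, ⊤) ⟶ CommRingCat.of T' :=
    CommRingCat.ofHom ((pullback.fst p q).appTop.hom.codRestrict T' h1)
  let i2 : Γ(W, ⊤) ⟶ CommRingCat.of T' :=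
    CommRingCat.ofHom ((pullback.snd p q).appTop.hom.codRestrict T' h2)
  have hi : p.appTop ≫ i1 = q.appTop ≫ i2 := by
    refine CommRingCat.hom_ext (RingHom.ext fun a => Subtype.ext ?_)
    exact congrArg (fun k => k.hom a) hP.w
  -- Functions on the affine fibre product form a pushout, so the inclusion of `T'` acquires a
  -- section and `T'` is everything. Surjectivity along the closed immersion then transfers this to
  -- `T`.
  have hd : hP.desc i1 i2 hi ≫ CommRingCat.ofHom T'.subtype = 𝟙 _ := by
    apply hP.hom_ext
    · rw [hP.inl_desc_assoc, Category.comp_id]; rfl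
    · rw [hP.inr_desc_assoc, Category.comp_id]; rfl
  have htop : ∀ b, b ∈ T' := fun b => by
    have := congrArg (fun k => k.hom b) hd
    rw [← show _ = b from this]
    exact ((hP.desc i1 i2 hi).hom b).2
  refine top_le_iff.1 fun z _ => ?_
  have : IsAffine (pullback p q) := inferInstance
  obtain ⟨b, rfl⟩ := Scheme.Hom.app_surjective (pullback.lift f g h) ⊤ (isAffineOpen_top _) z
  exact htop b

variable {X : Scheme.{u}}

theorem appTop_homOfLE_topIso {U V : X.Opens} (e : U ≤ V) :
    (X.homOfLE e).appTop ≫ U.topIso.hom = V.topIso.hom ≫ X.presheaf.map (homOfLE e).op := by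
  rw [Scheme.homOfLE_appTop]
  simp only [Scheme.Opens.topIso_hom]
  erw [← Functor.map_comp, ← Functor.map_comp]
  rfl

theorem appTop_ι_comp_topIso {S : Scheme.{u}} (π : X ⟶ S) (U : X.Opens) :
    (U.ι ≫ π).appTop ≫ U.topIso.hom = π.appLE ⊤ U le_top := by
  rw [Scheme.Hom.comp_appTop, Scheme.Opens.ι_appTop, Scheme.Opens.topIso_hom]
  erw [Category.assoc, ← Functor.map_comp]
  rfl

theorem appTop_morphismRestrict_topIso {Y : Scheme.{u}} (f : Y ⟶ X) (U : X.Opens) :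
    (f ∣_ U).appTop ≫ (f ⁻¹ᵁ U).topIso.hom = U.topIso.hom ≫ f.app U := by
  rw [morphismRestrict_appTop, Scheme.Opens.topIso_hom, Scheme.Opens.topIso_hom]
  erw [Category.assoc, ← Functor.map_comp, Scheme.Hom.naturality]
  rfl

theorem mem_of_range_le_comap {R S T : CommRingCat.{u}} (f : R ⟶ S) (e : S ≅ T) (g : R ⟶ T)
    (h : f ≫ e.hom = g) (A : Subring T) (hg : ∀ r, g.hom r ∈ A) :
    f.hom.range ≤ A.comap e.hom.hom := by
  rintro _ ⟨r, rfl⟩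
  change e.hom.hom (f.hom r) ∈ A
  rw [← CommRingCat.comp_apply, h]
  exact hg r

theorem eq_top_of_comap_eq_top {S T : CommRingCat.{u}} (e : S ≅ T) (A : Subring T)
    (h : A.comap e.hom.hom = ⊤) : A = ⊤ := by
  refine top_le_iff.1 fun t _ => ?_
  have : e.inv.hom t ∈ A.comap e.hom.hom := by rw [h]; trivial
  change e.hom.hom (e.inv.hom t) ∈ A at this
  rwa [← CommRingCat.comp_apply, e.inv_hom_id] at this

/-- On a separated scheme over an affine base, functions on the intersection of two affine opens are
generated by restrictions. -/
theorem subring_inf_eq_top {S : Scheme.{u}} [IsAffine S] (π : X ⟶ S) [IsSeparated π] {V W : X.Opens}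
    (hV : IsAffineOpen V) (hW : IsAffineOpen W) (T : Subring Γ(X, V ⊓ W))
    (h1 : ∀ s, res inf_le_left s ∈ T) (h2 : ∀ s, res inf_le_right s ∈ T) : T = ⊤ := by
  have : IsAffine V := hV
  have : IsAffine W := hW
  have hc : X.homOfLE (inf_le_left : V ⊓ W ≤ V) ≫ V.ι ≫ π =
      X.homOfLE (inf_le_right : V ⊓ W ≤ W) ≫ W.ι ≫ π := by simp
  have hpb := isPullback_opens_inf V W
  -- The intersection is `V ×_X W`, and its map to `V ×_S W` is a closed immersion by separatedness.
  have : IsClosedImmersion (pullback.lift _ _ hc) := by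
    have h : pullback.lift _ _ hc = hpb.isoPullback.hom ≫ pullback.mapDesc V.ι W.ι π := by
      apply pullback.hom_ext
      · rw [pullback.lift_fst, Category.assoc]
        refine Eq.symm ((congrArg (_ ≫ ·) ((pullback.lift_fst _ _ _).trans
          (Category.comp_id _))).trans ?_)
        exact hpb.isoPullback_hom_fst
      · rw [pullback.lift_snd, Category.assoc]
        refine Eq.symm ((congrArg (_ ≫ ·) ((pullback.lift_snd _ _ _).trans
          (Category.comp_id _))).trans ?_)
        exact hpb.isoPullback_hom_snd
    rw [h]
    infer_instance
  refine eq_top_of_comap_eq_top (V ⊓ W).topIso T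
    (subring_eq_top_of_isClosedImmersion _ _ hc _ ?_ ?_)
  · exact mem_of_range_le_comap _ _ _ (appTop_homOfLE_topIso _) T fun s => h1 _
  · exact mem_of_range_le_comap _ _ _ (appTop_homOfLE_topIso _) T fun s => h2 _

/-- Functions on an affine open subset of a base change are generated by constants and pulled back
functions. -/
theorem subring_preimage_eq_top {X' S S' : Scheme.{u}} [IsAffine S] [IsAffine S'] {j : X ⟶ X'}
    {π : X ⟶ S} {π' : X' ⟶ S'} {b : S ⟶ S'} (hpb : IsPullback j π π' b) {V : X'.Opens}
    (hV : IsAffineOpen V) (T : Subring Γ(X, j ⁻¹ᵁ V))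
    (h1 : ∀ s, pull j V s ∈ T) (h2 : ∀ s, (π.appLE ⊤ (j ⁻¹ᵁ V) le_top).hom s ∈ T) : T = ⊤ := by
  have : IsAffine V := hV
  -- Pasting squares identifies `j⁻¹ V` with `V ×_{S'} S`, so the comparison map is even an
  -- isomorphism.
  have hpb' := ((isPullback_morphismRestrict j V).flip.paste_horiz hpb.flip).flip
  have : IsClosedImmersion (pullback.lift _ _ hpb'.w) := by
    have h : pullback.lift _ _ hpb'.w = hpb'.isoPullback.hom := by
      apply pullback.hom_ext
      · exact (pullback.lift_fst _ _ _).trans hpb'.isoPullback_hom_fst.symm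
      · exact (pullback.lift_snd _ _ _).trans hpb'.isoPullback_hom_snd.symm
    rw [h]
    infer_instance
  refine eq_top_of_comap_eq_top (j ⁻¹ᵁ V).topIso T
    (subring_eq_top_of_isClosedImmersion _ _ hpb'.w _ ?_ ?_)
  · exact mem_of_range_le_comap _ _ _ (appTop_morphismRestrict_topIso _ _) T fun s => h1 _
  · exact mem_of_range_le_comap _ _ _ (appTop_ι_comp_topIso _ _) T fun s => h2 _

end Generation

/-! ### Bounded sets in intersections and base changes -/

section Bounded

variable {X : Scheme.{u}} {π : X ⟶ Spec (.of K)}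

/-- The functions bounded on `E` form a subring containing both families of restrictions, which
generate. -/
theorem BoundedIn.inf [IsSeparated π] {V W : X.Opens} (hV : IsAffineOpen V) (hW : IsAffineOpen W)
    {E : Set (Points π)} (h1 : BoundedIn V E) (h2 : BoundedIn W E) : BoundedIn (V ⊓ W) E := by
  refine ⟨fun x hx => (h1.lies x hx).inf (h2.lies x hx), fun s => ?_⟩
  have : boundedSubring (V ⊓ W) E = ⊤ := by
    refine subring_inf_eq_top π hV hW _ (fun s => ?_) fun s => ?_
    · obtain ⟨C, hC⟩ := h1.bounded s
      exact ⟨C, fun x hx h => by rw [eval_res]; exact hC x hx _⟩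
    · obtain ⟨C, hC⟩ := h2.bounded s
      exact ⟨C, fun x hx h => by rw [eval_res]; exact hC x hx _⟩
  have hs : s ∈ boundedSubring (V ⊓ W) E := by rw [this]; trivial
  exact hs

theorem eval_congr {x y : Spec (.of K) ⟶ X} (e : x = y) {U : X.Opens} (h : Lies x U) (h' : Lies y U)
    (s : Γ(X, U)) : eval x h s = eval y h' s := by
  subst e; rfl

theorem eval_appLE {Y : Scheme.{u}} (f : Y ⟶ X) (x : Spec (.of K) ⟶ Y) {U : X.Opens} {V : Y.Opens}
    (e : V ≤ f ⁻¹ᵁ U) (h : Lies x V) (h' : Lies (x ≫ f) U) (s : Γ(X, U)) :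
    eval x h ((f.appLE U V e).hom s) = eval (x ≫ f) h' s := by
  have : (f.appLE U V e).hom s = res e (pull f U s) := rfl
  rw [this, eval_res, eval_pull]

/-- Besides pulled back functions only constants are needed as generators, and their values are the
same at all rational points. -/
theorem boundedIn_preimage {X' S' : Scheme.{u}} [IsAffine S'] {j : X ⟶ X'} {π' : X' ⟶ S'}
    {b : Spec (.of K) ⟶ S'} (hpb : IsPullback j π π' b) {V : X'.Opens} (hV : IsAffineOpen V)
    {E : Set (Points π)} (hE : ∀ x ∈ E, Lies (x.pt ≫ j) V)
    (h : ∀ s : Γ(X', V), ∃ C, ∀ x ∈ E, ∀ h : Lies (x.pt ≫ j) V, ‖eval (x.pt ≫ j) h s‖ ≤ C) :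
    BoundedIn (j ⁻¹ᵁ V) E := by
  refine ⟨hE, fun s => ?_⟩
  have : boundedSubring (j ⁻¹ᵁ V) E = ⊤ := by
    refine subring_preimage_eq_top hpb hV _ (fun s => ?_) fun s => ?_
    · obtain ⟨C, hC⟩ := h s
      exact ⟨C, fun x hx h => by rw [eval_pull j x.pt h h]; exact hC x hx _⟩
    · have hU : Lies (𝟙 (Spec (.of K))) ⊤ := le_top
      refine ⟨‖eval (𝟙 (Spec (.of K))) hU s‖, fun x hx h => ?_⟩
      rw [eval_appLE π x.pt le_top h le_top, eval_congr x.comm le_top hU]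
  have hs : s ∈ boundedSubring (j ⁻¹ᵁ V) E := by rw [this]; trivial
  exact hs

end Bounded

/-! ### Integral points of models -/

section Integral

variable [IsUltrametricDist K]

theorem mem_valRing_iff (a : K) : a ∈ ValRing K ↔ ‖a‖ ≤ 1 := by
  rw [Valuation.mem_valuationSubring_iff, NormedField.valuation_apply, ← NNReal.coe_le_coe]
  rfl

/-- Injectivity of `R → K` gives density; together with separatedness this makes the integral
extension of a point unique. -/
instance isDominant_generic : IsDominant (generic K) := by
  refine ⟨(PrimeSpectrum.denseRange_comap_iff_ker_le_nilRadical
    (algebraMap (ValRing K) K)).2 ?_⟩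
  rw [(RingHom.injective_iff_ker_eq_bot _).1 Subtype.val_injective]
  exact bot_le

variable {X' : Scheme.{u}} {π' : X' ⟶ Spec (.of (ValRing K))}

theorem section_unique [IsSeparated π'] {x₁ x₂ : Spec (.of (ValRing K)) ⟶ X'} (h₁ : x₁ ≫ π' = 𝟙 _)
    (h₂ : x₂ ≫ π' = 𝟙 _) (h : generic K ≫ x₁ = generic K ≫ x₂) : x₁ = x₂ :=
  ext_of_isDominant_of_isSeparated π' (h₁.trans h₂.symm) (generic K) h

theorem norm_eval_le_one (x' : Spec (.of (ValRing K)) ⟶ X') {y : Spec (.of K) ⟶ X'}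
    (hy : generic K ≫ x' = y) {U : X'.Opens} (hU : ⊤ ≤ x' ⁻¹ᵁ U) (h : Lies y U) (s : Γ(X', U)) :
    ‖eval y h s‖ ≤ 1 := by
  rw [eval_specMap_comp (algebraMap (ValRing K) K) x' hy hU]
  exact (mem_valRing_iff _).1 (Subtype.prop _)

theorem lies_of_section {x' : Spec (.of (ValRing K)) ⟶ X'} {y : Spec (.of K) ⟶ X'}
    (hy : generic K ≫ x' = y) {U : X'.Opens} (hU : ⊤ ≤ x' ⁻¹ᵁ U) : Lies y U := by
  subst hy
  exact fun q _ => hU trivial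

/-- A section of a model factors through any open neighbourhood of the image of the closed point. -/
theorem top_le_preimage (x' : Spec (.of (ValRing K)) ⟶ X') {U : X'.Opens}
    (h : x' (IsLocalRing.closedPoint (ValRing K)) ∈ U) : ⊤ ≤ x' ⁻¹ᵁ U := by
  intro q _
  exact ((IsLocalRing.specializes_closedPoint q).map x'.continuous).mem_open U.isOpen h

/-- A point of an affine open subset of a model at which all functions take integral values extends
to a section. -/
theorem exists_section {V : X'.Opens} (hV : IsAffineOpen V) {y : Spec (.of K) ⟶ X'}
    (hy : y ≫ π' = generic K) (h : Lies y V) (hn : ∀ s, ‖eval y h s‖ ≤ 1) :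
    ∃ x' : Spec (.of (ValRing K)) ⟶ X', x' ≫ π' = 𝟙 _ ∧ generic K ≫ x' = y ∧ ⊤ ≤ x' ⁻¹ᵁ V := by
  let ρ : Γ(X', V) →+* ValRing K :=
    (eval y h).codRestrict (ValRing K).toSubring fun s => (mem_valRing_iff _).2 (hn s)
  let x' : Spec (.of (ValRing K)) ⟶ X' := Spec.map (CommRingCat.ofHom ρ) ≫ hV.fromSpec
  have h1 : generic K ≫ x' = y := by
    have h2 : generic K ≫ Spec.map (CommRingCat.ofHom ρ) =
        Spec.map (CommRingCat.ofHom (eval y h)) := by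
      rw [generic, ← Spec.map_comp]
      rfl
    have h3 : CommRingCat.ofHom (eval y h) = y.appLE V ⊤ h ≫ (Scheme.ΓSpecIso (.of K)).hom := rfl
    have h4 := hV.SpecMap_appLE_fromSpec y (isAffineOpen_top _) h
    rw [reassoc_of% h2, h3, Spec.map_comp, Category.assoc, h4]
    rw [IsAffineOpen.fromSpec_top, Scheme.isoSpec_Spec_inv, ← Spec.map_comp_assoc,
      Iso.inv_hom_id, Spec.map_id, Category.id_comp]
  refine ⟨x', ?_, h1, ?_⟩
  -- Being a section is an equality of endomorphisms of `R`, which can be tested in `K`.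
  · have h2 : generic K ≫ x' ≫ π' = generic K := by rw [reassoc_of% h1, hy]
    obtain ⟨φ, hφ⟩ := Spec.map_surjective (x' ≫ π')
    rw [← hφ] at h2 ⊢
    rw [generic, ← Spec.map_comp] at h2
    have h3 := Spec.map_injective h2
    rw [← Spec.map_id]
    congr 1
    refine CommRingCat.hom_ext (RingHom.ext fun a => Subtype.ext ?_)
    exact congrArg (fun k => k.hom a) h3
  · rintro q -
    change x' q ∈ V
    have : x' q ∈ hV.fromSpec.opensRange := ⟨_, rfl⟩
    rwa [hV.opensRange_fromSpec] at this

/-- Integrality of the values of functions may be checked on finitely many of them. -/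
theorem exists_finset_forall_norm_le [LocallyOfFiniteType π'] {V : X'.Opens}
    (hV : IsAffineOpen V) : ∃ t : Finset Γ(X', V), ∀ (y : Spec (.of K) ⟶ X')
      (_ : y ≫ π' = generic K) (h : Lies y V),
        (∀ s ∈ t, ‖eval y h s‖ ≤ 1) → ∀ s, ‖eval y h s‖ ≤ 1 := by
  have hft := π'.finiteType_appLE (isAffineOpen_top _) hV le_top
  let := (π'.appLE ⊤ V le_top).hom.toAlgebra
  obtain ⟨t, ht⟩ := hft.out
  refine ⟨t, fun y hy h hs s => ?_⟩
  have hs' : s ∈ Algebra.adjoin Γ(Spec (.of (ValRing K)), ⊤) (t : Set Γ(X', V)) := by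
    rw [ht]; trivial
  rw [← mem_valRing_iff]
  induction hs' using Algebra.adjoin_induction with
  | mem x hx => exact (mem_valRing_iff _).2 (hs x hx)
  | algebraMap r =>
    change eval y h ((π'.appLE ⊤ V le_top).hom r) ∈ _
    rw [eval_appLE π' y le_top h le_top, mem_valRing_iff]
    -- Scalars are functions on `Spec R` itself, whose identity is the integral point used here.
    exact norm_eval_le_one (𝟙 _) ((Category.comp_id _).trans hy.symm) le_top _ _
  | add a b _ _ ha hb => rw [map_add]; exact add_mem ha hb
  | mul a b _ _ ha hb => rw [map_mul]; exact mul_mem ha hb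

end Integral

/-! ### Model metrics -/

/-- The global section given by the frame `e_i`, if `U i` is everything. -/
def LineBundle.sectionOfTopLe {X : Scheme.{u}} (L : LineBundle X) (i : L.ι) (h : ⊤ ≤ L.U i) :
    L.Section where
  s k := res (le_inf le_rfl (le_top.trans h)) (L.g k i).1
  compat k l W hk hl := by
    have key : ∀ (a : L.ι) (ha : W ≤ L.U a),
        res ha (res (le_inf le_rfl (le_top.trans h)) (L.g a i).1) =
          res (le_inf ha (le_top.trans h)) (L.g a i).1 := by
      intro a ha
      rw [res, res, ← CommRingCat.comp_apply, ← Functor.map_comp]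
      rfl
    rw [key, key]
    exact (L.cocycle k l i W hk hl (le_top.trans h)).symm

namespace Model

variable [IsUltrametricDist K] {X : Scheme.{u}} {π : X ⟶ Spec (.of K)} {L : LineBundle X}
  (𝓜 : Model π L)

theorem comp_j_comp (x : Points π) : (x.pt ≫ 𝓜.j) ≫ 𝓜.π' = generic K := by
  rw [Category.assoc, 𝓜.isPullback.w, ← Category.assoc, x.comm, Category.id_comp]

/-- Elements of the lattice have integral coordinates in a frame at the reduction of the point. -/
theorem norm_le_one_of_mem_lattice {y : Spec (.of K) ⟶ 𝓜.X'} {x' : Spec (.of (ValRing K)) ⟶ 𝓜.X'}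
    (hx' : x' ≫ 𝓜.π' = 𝟙 _) (hy : generic K ≫ x' = y) (i : {i // Lies y (𝓜.L'.U i)})
    (hi : ⊤ ≤ x' ⁻¹ᵁ (𝓜.L'.U i.1)) {w : 𝓜.L'.Fiber y} (hw : w ∈ 𝓜.lattice y) : ‖w.1 i‖ ≤ 1 := by
  have := 𝓜.projective.isProper
  obtain ⟨x₂, h1, h2, s, hs⟩ := hw
  obtain rfl := section_unique h1 hx' (h2.trans hy.symm)
  have h' : Lies (generic K) (x₂ ⁻¹ᵁ (𝓜.L'.U i.1)) := fun q _ => hi trivial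
  rw [hs i.1 i.2 h']
  exact norm_eval_le_one (𝟙 _) (Category.comp_id _) hi h' _

/-- The frame extends over all of `Spec R`. With `norm_le_one_of_mem_lattice` this pins down the
unit ball of the model norm. -/
theorem frame_mem_lattice {y : Spec (.of K) ⟶ 𝓜.X'} {x' : Spec (.of (ValRing K)) ⟶ 𝓜.X'}
    (hx' : x' ≫ 𝓜.π' = 𝟙 _) (hy : generic K ≫ x' = y) (i : {i // Lies y (𝓜.L'.U i)})
    (hi : ⊤ ≤ x' ⁻¹ᵁ (𝓜.L'.U i.1)) : 𝓜.L'.frame y i ∈ 𝓜.lattice y := by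
  refine ⟨x', hx', hy, (𝓜.L'.pullback x').sectionOfTopLe i.1 hi, fun k h h' => ?_⟩
  subst hy
  have h1 := eval_res (generic K)
    (le_inf le_rfl (le_top.trans hi) : x' ⁻¹ᵁ 𝓜.L'.U k ≤ x' ⁻¹ᵁ (𝓜.L'.U k ⊓ 𝓜.L'.U i.1)) h'
    (pull x' (𝓜.L'.U k ⊓ 𝓜.L'.U i.1) (𝓜.L'.g k i.1).1)
  exact (h1.trans (eval_pull x' (generic K) _ (h.inf i.2) _)).symm

/-- The model metric in terms of a frame of the model at the reduction of the point. -/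
theorem norm_eq (x : Points π) {x' : Spec (.of (ValRing K)) ⟶ 𝓜.X'}
    (hx' : x' ≫ 𝓜.π' = 𝟙 _) (hy : generic K ≫ x' = x.pt ≫ 𝓜.j)
    (i : {i // Lies (x.pt ≫ 𝓜.j) (𝓜.L'.U i)}) (hi : ⊤ ≤ x' ⁻¹ᵁ (𝓜.L'.U i.1))
    (v : L.Fiber x.pt) :
    𝓜.norm x v = ‖(𝓜.L'.pullbackFiber 𝓜.j x.pt (𝓜.φ.fiberMap x.pt (L.tpow 𝓜.e v))).1 i‖ ^
      (1 / (𝓜.e : ℝ)) := by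
  set w := 𝓜.L'.pullbackFiber 𝓜.j x.pt (𝓜.φ.fiberMap x.pt (L.tpow 𝓜.e v)) with hw
  -- The infimum is attained at `a = w.1 i`, with the frame as lattice vector.
  refine IsLeast.csInf_eq ⟨⟨w.1 i, rfl, _, 𝓜.frame_mem_lattice hx' hy i hi,
    𝓜.L'.eq_smul_frame _ w i⟩, ?_⟩
  rintro _ ⟨a, rfl, w', hw', h⟩
  have h1 : w = a • w' := h
  refine Real.rpow_le_rpow (norm_nonneg _) ?_ (by positivity)
  rw [h1]
  change ‖a * w'.1 i‖ ≤ ‖a‖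
  rw [norm_mul]
  exact mul_le_of_le_one_right (norm_nonneg _) (𝓜.norm_le_one_of_mem_lattice hx' hy i hi hw')

/-- The `e`-th power of the frame has coordinate one, so only the unit of `φ` survives. -/
theorem norm_frame_eq (x : Points π) {x' : Spec (.of (ValRing K)) ⟶ 𝓜.X'}
    (hx' : x' ≫ 𝓜.π' = 𝟙 _) (hy : generic K ≫ x' = x.pt ≫ 𝓜.j)
    (i : {i // Lies (x.pt ≫ 𝓜.j) (𝓜.L'.U i)}) (hi : ⊤ ≤ x' ⁻¹ᵁ (𝓜.L'.U i.1))
    (k : {k // Lies x.pt (L.U k)}) :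
    𝓜.norm x (L.frame x.pt k) =
      ‖eval x.pt (U := L.U k.1 ⊓ 𝓜.j ⁻¹ᵁ (𝓜.L'.U i.1)) (k.2.inf i.2) (𝓜.φ.u k.1 i.1).1‖ ^
        (1 / (𝓜.e : ℝ)) := by
  rw [𝓜.norm_eq x hx' hy i hi]
  have h2 : (L.tpow 𝓜.e (L.frame x.pt k)).1 k = 1 :=
    (congrArg (· ^ 𝓜.e) (L.frame_self x.pt k)).trans (one_pow _)
  have h := 𝓜.φ.fiberMap_apply x.pt (L.tpow 𝓜.e (L.frame x.pt k)) k ⟨i.1, i.2⟩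
  rw [h2, mul_one] at h
  exact congrArg (fun z => ‖z‖ ^ (1 / (𝓜.e : ℝ))) h

/-- A point at which the model metric does not vanish extends to an integral point. -/
theorem exists_section_of_norm_pos {x : Points π} {v : L.Fiber x.pt} (h : 0 < 𝓜.norm x v) :
    ∃ x' : Spec (.of (ValRing K)) ⟶ 𝓜.X', x' ≫ 𝓜.π' = 𝟙 _ ∧ generic K ≫ x' = x.pt ≫ 𝓜.j := by
  obtain ⟨_, a, rfl, w, ⟨x', h1, h2, -⟩, -⟩ : {r | ∃ a : K, r = ‖a‖ ^ (1 / (𝓜.e : ℝ)) ∧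
      ∃ w ∈ 𝓜.lattice (x.pt ≫ 𝓜.j), 𝓜.L'.pullbackFiber 𝓜.j x.pt
        (𝓜.φ.fiberMap x.pt (L.tpow 𝓜.e v)) = a • w}.Nonempty := by
    -- Without an integral extension the lattice is empty, and the infimum of the empty set is zero
    -- by convention.
    by_contra hne
    rw [Set.not_nonempty_iff_eq_empty] at hne
    rw [norm, hne, Real.sInf_empty] at h
    exact lt_irrefl _ h
  exact ⟨x', h1, h2⟩

/-- Around the image of an integral point there are affine open neighbourhoods on which the line
bundle of the model is trivial. -/
theorem exists_affine_nhd (p : 𝓜.X') :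
    ∃ (V : 𝓜.X'.Opens) (i : 𝓜.L'.ι), IsAffineOpen V ∧ p ∈ V ∧ V ≤ 𝓜.L'.U i := by
  have hp : p ∈ ⨆ i, 𝓜.L'.U i := by rw [𝓜.L'.cover]; trivial
  obtain ⟨i, hi⟩ := Opens.mem_iSup.1 hp
  obtain ⟨V, hV, hpV, hVi⟩ := Opens.isBasis_iff_nbhd.1 𝓜.X'.isBasis_affineOpens hi
  exact ⟨V, i, hV, hpV, hVi⟩

end Model

/-! ### Continuity and local boundedness from a model -/

namespace Metric

variable [IsUltrametricDist K] {X : Scheme.{u}} {π : X ⟶ Spec (.of K)} {L : LineBundle X}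

/-- Positivity of `m` on a frame makes the model norm positive there, so no valuative criterion is
invoked. -/
theorem exists_section_of_eq_exp_mul {m : Metric π L} {𝓜 : Model π L} {u : Points π → ℝ}
    (h : ∀ (x : Points π) (v : L.Fiber x.pt), m.norm x v = Real.exp (u x) * 𝓜.norm x v)
    (x : Points π) :
    ∃ x' : Spec (.of (ValRing K)) ⟶ 𝓜.X', x' ≫ 𝓜.π' = 𝟙 _ ∧ generic K ≫ x' = x.pt ≫ 𝓜.j := by
  have h1 := m.norm_frame_pos x (L.idx x.pt)
  rw [h] at h1
  exact 𝓜.exists_section_of_norm_pos (pos_of_mul_pos_right h1 (Real.exp_pos _).le)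

theorem IsModelBoundedContinuous.isContinuous {m : Metric π L}
    (hm : m.IsModelBoundedContinuous) : m.IsContinuous := by
  obtain ⟨𝓜, u, hu, -, h⟩ := hm
  have := 𝓜.projective.isProper
  intro k
  refine continuous_iff_continuousAt.2 fun x => ?_
  obtain ⟨x', hx', hy⟩ := exists_section_of_eq_exp_mul h x.1
  obtain ⟨V, i, hV, hpV, hVi⟩ := 𝓜.exists_affine_nhd (x' (IsLocalRing.closedPoint _))
  have hxV := top_le_preimage x' hpV
  obtain ⟨t, ht⟩ := exists_finset_forall_norm_le (K := K) (π' := 𝓜.π') hV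
  -- Points with integral values on finitely many generators of `Γ(X', V)` extend to integral points
  -- inside `V`, where one frame of `L'` computes all norms. `S` is open because the closed unit
  -- ball is open in an ultrametric field.
  let S : Set {x : Points π // Lies x.pt (L.U k)} :=
    {y | Lies y.1.pt (𝓜.j ⁻¹ᵁ V) ∧ ∀ s ∈ t, ∃ h : Lies y.1.pt (𝓜.j ⁻¹ᵁ V),
      eval y.1.pt h (pull 𝓜.j V s) ∈ Metric.closedBall (0 : K) 1}
  have hS : IsOpen S := by
    refine IsOpen.inter ((Points.isOpen_lies _).preimage continuous_subtype_val) ?_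
    have : {y : {x : Points π // Lies x.pt (L.U k)} | ∀ s ∈ t,
        ∃ h : Lies y.1.pt (𝓜.j ⁻¹ᵁ V), eval y.1.pt h (pull 𝓜.j V s) ∈
          Metric.closedBall (0 : K) 1} = ⋂ s ∈ t, Subtype.val ⁻¹' {y : Points π |
        ∃ h : Lies y.pt (𝓜.j ⁻¹ᵁ V), eval y.pt h (pull 𝓜.j V s) ∈
          Metric.closedBall (0 : K) 1} := by
      ext y; simp
    change IsOpen {y : {x : Points π // Lies x.pt (L.U k)} | _}
    rw [this]
    exact isOpen_biInter_finset fun s _ => (Points.isOpen_eval_mem _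
      (IsUltrametricDist.isOpen_closedBall 0 one_ne_zero)).preimage continuous_subtype_val
  have hxS : x ∈ S := by
    have hl : Lies x.1.pt (𝓜.j ⁻¹ᵁ V) := lies_of_section hy hxV
    refine ⟨hl, fun s _ => ⟨hl, ?_⟩⟩
    rw [mem_closedBall_zero_iff, eval_pull 𝓜.j x.1.pt hl hl]
    exact norm_eval_le_one x' hy hxV _ s
  refine ContinuousOn.continuousAt ?_ (hS.mem_nhds hxS)
  rw [continuousOn_iff_continuous_domRestrict]
  have hl : ∀ y : S, Lies y.1.1.pt (L.U k ⊓ 𝓜.j ⁻¹ᵁ (𝓜.L'.U i)) := fun y =>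
    y.1.2.inf fun q hq => hVi (y.2.1 hq)
  have h1 : Continuous fun y : S => ‖eval y.1.1.pt (hl y) (𝓜.φ.u k i).1‖ :=
    ((Points.continuous_eval (π := π) (𝓜.φ.u k i).1).comp
      ((continuous_subtype_val.comp continuous_subtype_val).subtype_mk hl)).norm
  have h2 : Continuous fun y : S => Real.exp (u y.1.1) := by fun_prop
  refine Continuous.congr (h2.mul (h1.rpow_const (p := 1 / (𝓜.e : ℝ))
    fun _ => Or.inr (by positivity))) fun y => ?_
  have hyV : Lies (y.1.1.pt ≫ 𝓜.j) V := y.2.1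
  obtain ⟨y', h3, h4, h5⟩ := exists_section hV (𝓜.comp_j_comp y.1.1) hyV
    (ht _ (𝓜.comp_j_comp y.1.1) hyV fun s hs => by
      obtain ⟨hl', hs'⟩ := y.2.2 s hs
      rw [mem_closedBall_zero_iff, eval_pull 𝓜.j y.1.1.pt hl' hyV] at hs'
      exact hs')
  refine Eq.trans ?_ (h y.1.1 (L.frame y.1.1.pt ⟨k, y.1.2⟩)).symm
  rw [𝓜.norm_frame_eq y.1.1 h3 h4 ⟨i, fun q hq => hVi (hyV hq)⟩ (h5.trans fun q hq => hVi hq)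
    ⟨k, y.1.2⟩]
  rfl

theorem IsModelBoundedContinuous.isLocallyBounded {m : Metric π L} [IsSeparated π]
    (hm : m.IsModelBoundedContinuous) : m.IsLocallyBounded := by
  obtain ⟨𝓜, u, -, ⟨B, hB⟩, h⟩ := hm
  have := 𝓜.projective.isProper
  have : CompactSpace 𝓜.X' :=
    (quasiCompact_iff_compactSpace 𝓜.π').1 inferInstance
  intro k V hVk hV E hE
  choose W i hW hpW hWi using 𝓜.exists_affine_nhd
  obtain ⟨t, ht⟩ := isCompact_univ.elim_finite_subcover (fun p => (W p : Set 𝓜.X'))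
    (fun p => (W p).isOpen) fun p _ => Set.mem_iUnion.2 ⟨p, hpW p⟩
  -- The points of `E` reducing into `W p`. Functions on `W p` have values of norm at most one
  -- there, so `F p` is bounded, and the finitely many `p ∈ t` exhaust `E`.
  let F : 𝓜.X' → Set (Points π) := fun p => {x | (∃ hx : Lies x.pt V, ⟨x, hx⟩ ∈ E) ∧
    ∃ x' : Spec (.of (ValRing K)) ⟶ 𝓜.X', x' ≫ 𝓜.π' = 𝟙 _ ∧ generic K ≫ x' = x.pt ≫ 𝓜.j ∧
      ⊤ ≤ x' ⁻¹ᵁ (W p)}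
  have hj : ∀ p, IsAffineOpen (𝓜.j ⁻¹ᵁ (W p)) := fun p => by
    have : IsAffineHom 𝓜.j := MorphismProperty.of_isPullback 𝓜.isPullback.flip
      (inferInstance : IsAffineHom (generic K))
    exact (hW p).preimage 𝓜.j
  have hF : ∀ p, BoundedIn (V ⊓ 𝓜.j ⁻¹ᵁ (W p)) (F p) := fun p => by
    refine BoundedIn.inf hV (hj p) ⟨fun x hx => hx.1.1, fun s => ?_⟩
      (boundedIn_preimage 𝓜.isPullback (hW p) ?_ fun s => ⟨1, ?_⟩)
    · obtain ⟨C, hC⟩ := hE s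
      exact ⟨C, fun x hx h => hC ⟨x, h⟩ hx.1.2⟩
    · rintro x ⟨-, x', -, h2, h3⟩
      exact lies_of_section h2 h3
    · rintro x ⟨-, x', -, h2, h3⟩ hl
      exact norm_eval_le_one x' h2 h3 hl s
  choose C hC using fun p => (hF p).exists_abs_log_le
    (Units.map (res (inf_le_inf hVk fun q hq => hWi p hq) :
      Γ(X, L.U k ⊓ 𝓜.j ⁻¹ᵁ (𝓜.L'.U (i p))) →+* Γ(X, V ⊓ 𝓜.j ⁻¹ᵁ (W p))).toMonoidHom (𝓜.φ.u k (i p)))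
  refine ⟨B + ∑ p ∈ t, |C p|, fun x hx => ?_⟩
  obtain ⟨x', hx', hy⟩ := exists_section_of_eq_exp_mul h x.1
  obtain ⟨p, hp, hpx⟩ := Set.mem_iUnion₂.1 (ht (Set.mem_univ (x' (IsLocalRing.closedPoint _))))
  have hxW := top_le_preimage x' hpx
  have hxi : ⊤ ≤ x' ⁻¹ᵁ (𝓜.L'.U (i p)) := hxW.trans fun q hq => hWi p hq
  have hl : Lies (x.1.pt ≫ 𝓜.j) (W p) := lies_of_section hy hxW
  have hxF : x.1 ∈ F p := ⟨⟨x.2, hx⟩, x', hx', hy, hxW⟩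
  have h1 := hC p x.1 hxF ((hF p).lies _ hxF)
  have h2 := 𝓜.norm_frame_eq x.1 hx' hy ⟨i p, fun q hq => hWi p (hl hq)⟩ hxi ⟨k, x.2.mono hVk⟩
  have h3 : |Real.log (𝓜.norm x.1 (L.frame x.1.pt ⟨k, x.2.mono hVk⟩))| ≤ C p := by
    rw [h2]
    have h0 : 0 < ‖eval x.1.pt (U := L.U k ⊓ 𝓜.j ⁻¹ᵁ (𝓜.L'.U (i p)))
        ((x.2.mono hVk).inf fun q hq => hWi p (hl hq)) (𝓜.φ.u k (i p)).1‖ :=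
      norm_pos_iff.2 (LineBundle.eval_unit_ne_zero _ _)
    rw [Real.log_rpow h0, abs_mul]
    -- As `e ≥ 1`, the root only shrinks the logarithm.
    have h4 : |1 / (𝓜.e : ℝ)| ≤ 1 := by
      have : (1 : ℝ) ≤ 𝓜.e := by exact_mod_cast 𝓜.e_pos
      rw [abs_of_nonneg (by positivity)]
      exact (div_le_one (by positivity)).2 this
    refine (mul_le_of_le_one_left (abs_nonneg _) h4).trans ?_
    have h5 := eval_res x.1.pt (inf_le_inf hVk fun q hq => hWi p hq :
      V ⊓ 𝓜.j ⁻¹ᵁ (W p) ≤ L.U k ⊓ 𝓜.j ⁻¹ᵁ (𝓜.L'.U (i p))) ((hF p).lies _ hxF) (𝓜.φ.u k (i p)).1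
    rw [← h5]
    exact h1
  have h6 : 0 < 𝓜.norm x.1 (L.frame x.1.pt ⟨k, x.2.mono hVk⟩) := by
    have := m.norm_frame_pos x.1 ⟨k, x.2.mono hVk⟩
    rw [h] at this
    exact pos_of_mul_pos_right this (Real.exp_pos _).le
  rw [h, Real.log_mul (Real.exp_pos _).ne' h6.ne', Real.log_exp]
  refine (abs_add_le _ _).trans (add_le_add (hB _) (h3.trans ((le_abs_self _).trans ?_)))
  exact Finset.single_le_sum (f := fun p => |C p|) (fun _ _ => abs_nonneg _) hp

end Metric

/-! ### Both kinds of fields together, and the theorem -/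

theorem Metric.IsBoundedContinuous.isContinuous {X : Scheme.{u}} {π : X ⟶ Spec (.of K)}
    {L : LineBundle X} {m : Metric π L} (hm : m.IsBoundedContinuous) : m.IsContinuous := by
  rcases hm with ⟨hK, h⟩ | ⟨-, h, -⟩
  · exact h.isContinuous
  · exact h

theorem Metric.IsBoundedContinuous.isLocallyBounded {X : Scheme.{u}} {π : X ⟶ Spec (.of K)}
    [IsSeparated π] {L : LineBundle X} {m : Metric π L} (hm : m.IsBoundedContinuous) :
    m.IsLocallyBounded := by
  rcases hm with ⟨hK, h⟩ | ⟨-, -, h⟩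
  · exact h.isLocallyBounded
  · exact h

end AdmMetric

end

theorem theorem5p1 {K : Type u} [NormedField K] [IsAlgClosed K] {X : Scheme.{u}}
    [AlgebraicGeometry.IsIntegral X] (π : X ⟶ Spec (.of K)) (hπ : AdmMetric.IsProjectiveOver π)
    (L : AdmMetric.LineBundle X) (m : AdmMetric.Metric π L) (hm : m.IsBoundedContinuous) :
    (∃! h : AdmMetric.BoundedSeq m → AdmMetric.Metric π L, AdmMetric.IsAdmissibleFamily m h) ∧
    ∀ m' : AdmMetric.Metric π L, m'.IsBoundedContinuous →
      AdmMetric.BoundedSeq m' = AdmMetric.BoundedSeq m ∧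
      ∀ (h : AdmMetric.BoundedSeq m → AdmMetric.Metric π L)
        (h' : AdmMetric.BoundedSeq m' → AdmMetric.Metric π L),
        AdmMetric.IsAdmissibleFamily m h → AdmMetric.IsAdmissibleFamily m' h' →
        ∀ (p : ℕ → AdmMetric.EndPair π L) (hp : p ∈ AdmMetric.BoundedSeq m)
          (hp' : p ∈ AdmMetric.BoundedSeq m'), h' ⟨p, hp'⟩ = h ⟨p, hp⟩ := by
  have := hπ.isProper
  have dist : ∀ m' : AdmMetric.Metric π L, m'.IsBoundedContinuous →
      ∃ B, ∀ x, |m.logRatio m' x| ≤ B := fun m' hm' =>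
    hm.isLocallyBounded.exists_abs_logRatio_le hπ hm'.isLocallyBounded
  refine ⟨?_, fun m' hm' => ?_⟩
  -- Uniqueness is the comparison of families in the special case `m' = m`.
  · obtain ⟨B, hB⟩ := dist m hm
    obtain ⟨h, hh⟩ := AdmMetric.exists_isAdmissibleFamily hm hm.isContinuous
    exact ⟨h, hh, fun h' hh' => funext fun p => hh.eq hB hh' p.1 p.2 p.2⟩
  · obtain ⟨B, hB⟩ := dist m' hm'
    refine ⟨(AdmMetric.boundedSeq_subset (B := B) fun x => ?_).antisymm
      (AdmMetric.boundedSeq_subset hB),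
      fun h h' hh hh' p hp hp' => hh.eq hB hh' p hp hp'⟩
    rw [AdmMetric.Metric.logRatio_symm, abs_neg]
    exact hB x
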